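/- Let $\mathbf{k}$ be an algebraically closed field of characteristic $0$, let $U=\mathbf{k}^2$, let $d\ge 0$ and let $\lambda$ be a partition of $d$. Let $$A=\bigoplus_{m\ge 0} A_m,\qquad A_m=(\operatorname{Sym}^m U)^{\otimes d},$$ with its natural action of $\mathbf{GL}(U)$ and with the symmetric group $\mathfrak{S}_d$ permuting the tensor factors. Let $V_\lambda=\mathbf{k}[\mathfrak{S}_d]\,c_\lambda$ be the irreducible $\mathfrak{S}_d$-representation indexed by $\lambda$, where $c_\lambda$ is a Young symmetrizer of shape $\lambda$ (so $V_{(d)}$ is trivial and $V_{(1^d)}$ is the sign representation). Let $M_\lambda=\operatorname{Hom}_{\mathfrak{S}_d}(V_\lambda,A)$ be the module of $\lambda$-covariants, graded by $(M_\lambda)_m=\operatorname{Hom}_{\mathfrak{S}_d}(V_\lambda,A_m)$. For a polynomial representation $L$ of $\mathbf{GL}(U)$ of degree $e$, put $\operatorname{ch}(L)=\sum_{i=0}^{e}\dim(L_{i,e-i})\,q^i$, where $L_{i,j}$ is the subspace on which $\operatorname{diag}(t_1,t_2)$ acts as $t_1^it_2^j$ for all $t_1,t_2\in\mathbf{k}^*$.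 The component $(M_\lambda)_m$ is a polynomial representation of degree $dm$, and the equivariant Hilbert series of $M_\lambda$ is $\mathrm{H}_{M_\lambda}(t)=\sum_{m\ge 0}\operatorname{ch}((M_\lambda)_m)\,t^m$. Then, in $\mathbf{Z}[q][[t]]$, $$\mathrm{H}_{M_\lambda}(t)=\sum_{m\ge 0}s_\lambda(1,q,\dots,q^m)\,t^m=\frac{\sum_{T\in\mathrm{SYT}(\lambda)}t^{\mathrm{des}(T)}q^{\mathrm{maj}(T)}}{(1-t)(1-qt)\cdots(1-q^dt)}.$$ Here $s_\lambda(x_0,\dots,x_m)$ is the Schur polynomial, that is, the sum of the monomials $\prod_{c\in\lambda}x_{S(c)}$ over all semistandard tableaux $S$ of shape $\lambda$ with entries in $\{0,\dots,m\}$. Further, $\mathrm{SYT}(\lambda)$ is the set of standard Young tableaux of shape $\lambda$ with entries $1,\dots,d$, a descent of $T$ is an $i$ such that $i+1$ appears in a lower row of $T$ than $i$ (rows are numbered from top to bottom), $\mathrm{des}(T)$ is the number of descents of $T$, and $\mathrm{maj}(T)$ is the sum of the descents of $T$. -/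

import Mathlib

open scoped DirectSum

namespace Covariants

noncomputable section

/-! ### The rings and their group actions

Throughout, `U = k^(n+1)` with its standard basis, so that `GL(U)` is the matrix group. -/

/-- The ring `Sym(U ⊕ ⋯ ⊕ U)` (`d` summands): polynomials in the variables `u^{(i)}_j = X (i, j)`,
where `u^{(i)}_0, …, u^{(i)}_n` is the standard basis of the `i`-th copy of `U`. -/
abbrev CoordRing (k : Type*) [Field k] (d n : ℕ) : Type _ :=
  MvPolynomial (Fin d × Fin (n + 1)) k

/-- The linear substitution given by a matrix `g`, acting on every copy of `U` by
`u_j ↦ ∑ l, g l j • u_l` (the `j`-th column of `g`). -/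
def glSubst {k : Type*} [Field k] {d n : ℕ} (g : Matrix (Fin (n + 1)) (Fin (n + 1)) k) :
    CoordRing k d n →ₐ[k] CoordRing k d n :=
  MvPolynomial.aeval fun p => ∑ l, MvPolynomial.C (g l p.2) * MvPolynomial.X (p.1, l)

/-- The action of `GL(U)` on `Sym(U ⊕ ⋯ ⊕ U)` by algebra automorphisms. -/
def glRep (k : Type*) [Field k] (d n : ℕ) :
    Representation k (Matrix.GeneralLinearGroup (Fin (n + 1)) k) (CoordRing k d n) where
  toFun g := (glSubst (g : Matrix (Fin (n + 1)) (Fin (n + 1)) k)).toLinearMap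
  map_one' := by
    have h : glSubst (1 : Matrix (Fin (n + 1)) (Fin (n + 1)) k) = AlgHom.id k (CoordRing k d n) := by
      ext1 p
      simp [glSubst, Matrix.one_apply, apply_ite (MvPolynomial.C (σ := Fin d × Fin (n + 1)) (R := k)),
        ite_mul]
    rw [Units.val_one, h]
    rfl
  map_mul' g h := by
    have H : glSubst ((g : Matrix (Fin (n + 1)) (Fin (n + 1)) k) *
        (h : Matrix (Fin (n + 1)) (Fin (n + 1)) k)) =
        (glSubst (d := d) (g : Matrix (Fin (n + 1)) (Fin (n + 1)) k)).comp
          (glSubst (h : Matrix (Fin (n + 1)) (Fin (n + 1)) k)) := by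
      ext1 p
      simp only [glSubst, MvPolynomial.aeval_X, AlgHom.comp_apply, map_sum, map_mul,
        MvPolynomial.algHom_C, Matrix.mul_apply, MvPolynomial.algebraMap_eq, Finset.sum_mul,
        Finset.mul_sum]
      rw [Finset.sum_comm]
      refine Finset.sum_congr rfl fun a _ => Finset.sum_congr rfl fun b _ => ?_
      ring
    rw [Units.val_mul, H]
    rfl

/-- The action of the symmetric group on `Sym(U ⊕ ⋯ ⊕ U) = Sym(U) ⊗ ⋯ ⊗ Sym(U)` by permuting the
tensor factors. -/
def permRep (k : Type*) [Field k] (d n : ℕ) :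
    Representation k (Equiv.Perm (Fin d)) (CoordRing k d n) where
  toFun σ := (MvPolynomial.rename (Prod.map σ id)).toLinearMap
  map_one' := by
    refine LinearMap.ext fun p => ?_
    change MvPolynomial.rename (Prod.map (fun x => x) id) p = p
    exact MvPolynomial.rename_id_apply p
  map_mul' σ τ := by
    refine LinearMap.ext fun p => ?_
    exact (MvPolynomial.rename_rename (Prod.map τ id) (Prod.map σ id) p).symm

/-- The weights defining the `ℤ^d`-grading: `u^{(i)}_j` has degree the `i`-th unit vector. -/
def multiWeight (d n : ℕ) (p : Fin d × Fin (n + 1)) : Fin d → ℕ := Pi.single p.1 1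

/-- The component of multidegree `(m, …, m)`, that is `Sym^m U ⊗ ⋯ ⊗ Sym^m U`. -/
def segrePiece (k : Type*) [Field k] (d n m : ℕ) : Submodule k (CoordRing k d n) :=
  MvPolynomial.weightedHomogeneousSubmodule k (multiWeight d n) (fun _ => m)

theorem glSubst_isWeightedHomogeneous {k : Type*} [Field k] {d n : ℕ}
    (g : Matrix (Fin (n + 1)) (Fin (n + 1)) k) {e : Fin d → ℕ} {p : CoordRing k d n}
    (hp : MvPolynomial.IsWeightedHomogeneous (multiWeight d n) p e) :
    MvPolynomial.IsWeightedHomogeneous (multiWeight d n) (glSubst g p) e := by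
  classical
  rw [p.as_sum, map_sum]
  refine MvPolynomial.IsWeightedHomogeneous.sum _ _ _ fun s hs => ?_
  have hw : Finsupp.weight (multiWeight d n) s = e := hp (MvPolynomial.mem_support_iff.mp hs)
  rw [glSubst, MvPolynomial.aeval_monomial, MvPolynomial.algebraMap_eq]
  refine MvPolynomial.IsWeightedHomogeneous.C_mul ?_ _
  rw [← hw, Finsupp.weight_apply]
  refine MvPolynomial.IsWeightedHomogeneous.prod _ _ _ fun q _ => ?_
  refine MvPolynomial.IsWeightedHomogeneous.pow ?_ _
  refine MvPolynomial.IsWeightedHomogeneous.sum _ _ _ fun l _ => ?_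
  exact MvPolynomial.IsWeightedHomogeneous.C_mul
    (MvPolynomial.isWeightedHomogeneous_X k (multiWeight d n) (q.1, l)) _

theorem rename_isWeightedHomogeneous {k : Type*} [Field k] {d n m : ℕ}
    (σ : Equiv.Perm (Fin d)) {p : CoordRing k d n}
    (hp : MvPolynomial.IsWeightedHomogeneous (multiWeight d n) p (fun _ => m)) :
    MvPolynomial.IsWeightedHomogeneous (multiWeight d n)
      (MvPolynomial.rename (Prod.map σ id) p) (fun _ => m) := by
  classical
  rw [p.as_sum, map_sum]
  refine MvPolynomial.IsWeightedHomogeneous.sum _ _ _ fun s hs => ?_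
  have hw : Finsupp.weight (multiWeight d n) s = fun _ => m :=
    hp (MvPolynomial.mem_support_iff.mp hs)
  rw [MvPolynomial.rename_monomial]
  refine MvPolynomial.isWeightedHomogeneous_monomial _ _ _ ?_
  rw [Finsupp.weight_apply, Finsupp.sum_mapDomain_index (by simp) (by simp [add_smul])]
  funext i
  have hi := congrFun hw (σ.symm i)
  rw [Finsupp.weight_apply, Finsupp.sum, Finset.sum_apply] at hi
  rw [Finsupp.sum, Finset.sum_apply, ← hi]
  refine Finset.sum_congr rfl fun q _ => ?_
  simp [multiWeight, Pi.single_apply, Equiv.symm_apply_eq]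

/-- `GL(U)` acting on `Sym^m U ⊗ ⋯ ⊗ Sym^m U`. -/
def glRepPiece (k : Type*) [Field k] (d n m : ℕ) :
    Representation k (Matrix.GeneralLinearGroup (Fin (n + 1)) k) (segrePiece k d n m) :=
  (glRep k d n).subrepresentation (segrePiece k d n m) fun g _ hp =>
    glSubst_isWeightedHomogeneous (g : Matrix (Fin (n + 1)) (Fin (n + 1)) k) hp

/-- The symmetric group acting on `Sym^m U ⊗ ⋯ ⊗ Sym^m U`. -/
def permRepPiece (k : Type*) [Field k] (d n m : ℕ) :
    Representation k (Equiv.Perm (Fin d)) (segrePiece k d n m) :=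
  (permRep k d n).subrepresentation (segrePiece k d n m) fun σ _ hp =>
    rename_isWeightedHomogeneous σ hp

/-- `A = ⨁_{m ≥ 0} Sym^m U ⊗ ⋯ ⊗ Sym^m U` (`d` tensor factors). -/
abbrev SegreRing (k : Type*) [Field k] (d n : ℕ) : Type _ := ⨁ m : ℕ, segrePiece k d n m

/-- The action of `GL(U)` on `A`. -/
def glRepA (k : Type*) [Field k] (d n : ℕ) :
    Representation k (Matrix.GeneralLinearGroup (Fin (n + 1)) k) (SegreRing k d n) :=
  Representation.directSum fun m => glRepPiece k d n m

/-- The action of the symmetric group on `A`. -/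
def permRepA (k : Type*) [Field k] (d n : ℕ) :
    Representation k (Equiv.Perm (Fin d)) (SegreRing k d n) :=
  Representation.directSum fun m => permRepPiece k d n m

/-- The two actions on `A` commute. -/
theorem glRepA_permRepA_comm (k : Type*) [Field k] (d n : ℕ)
    (g : Matrix.GeneralLinearGroup (Fin (n + 1)) k) (σ : Equiv.Perm (Fin d)) :
    glRepA k d n g ∘ₗ permRepA k d n σ = permRepA k d n σ ∘ₗ glRepA k d n g := by
  have key : ∀ p : CoordRing k d n, glRep k d n g (permRep k d n σ p) =
      permRep k d n σ (glRep k d n g p) := by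
    intro p
    have h : (glSubst (g : Matrix (Fin (n + 1)) (Fin (n + 1)) k)).comp
          (MvPolynomial.rename (Prod.map σ id)) =
        (MvPolynomial.rename (R := k) (Prod.map σ id)).comp (glSubst (d := d)
          (g : Matrix (Fin (n + 1)) (Fin (n + 1)) k)) := by
      ext1 p
      simp [glSubst]
    exact congrArg (fun f => f p) h
  refine DirectSum.linearMap_ext _ fun m => LinearMap.ext fun x => ?_
  simp only [glRepA, permRepA, Representation.directSum, LinearMap.comp_apply, MonoidHom.coe_mk,
    OneHom.coe_mk, DirectSum.lmap_lof]
  congr 1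
  exact Subtype.ext (key x)

/-! ### The irreducible representations of the symmetric group -/

/-- The row group of a numbering `T` of the cells of `μ`: permutations preserving each row. -/
def rowGroup {μ : YoungDiagram} {d : ℕ} (T : μ.cells ≃ Fin d) : Set (Equiv.Perm (Fin d)) :=
  {σ | ∀ i, (T.symm (σ i)).1.1 = (T.symm i).1.1}

/-- The column group of a numbering `T` of the cells of `μ`: permutations preserving each column. -/
def colGroup {μ : YoungDiagram} {d : ℕ} (T : μ.cells ≃ Fin d) : Set (Equiv.Perm (Fin d)) :=
  {σ | ∀ i, (T.symm (σ i)).1.2 = (T.symm i).1.2}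

open Classical in
/-- The Young symmetrizer `c = a * b`, where `a` is the sum of the row group and `b` is the signed
sum of the column group. -/
def youngSymmetrizer (k : Type*) [Field k] {μ : YoungDiagram} {d : ℕ} (T : μ.cells ≃ Fin d) :
    MonoidAlgebra k (Equiv.Perm (Fin d)) :=
  (∑ σ with σ ∈ rowGroup T, MonoidAlgebra.single σ (1 : k)) *
    ∑ σ with σ ∈ colGroup T, MonoidAlgebra.single σ (((Equiv.Perm.sign σ : ℤˣ) : ℤ) : k)

/-- The underlying space of the irreducible representation `V_μ`: the left ideal of the group
algebra generated by the Young symmetrizer. -/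
def spechtModule (k : Type*) [Field k] {μ : YoungDiagram} {d : ℕ} (T : μ.cells ≃ Fin d) :
    Submodule k (MonoidAlgebra k (Equiv.Perm (Fin d))) :=
  LinearMap.range (LinearMap.mulRight k (youngSymmetrizer k T))

/-- The left regular representation of the symmetric group. -/
def regRep (k : Type*) [Field k] (d : ℕ) :
    Representation k (Equiv.Perm (Fin d)) (MonoidAlgebra k (Equiv.Perm (Fin d))) where
  toFun σ := LinearMap.mulLeft k (MonoidAlgebra.single σ 1)
  map_one' := by
    rw [← MonoidAlgebra.one_def, LinearMap.mulLeft_one]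
    rfl
  map_mul' σ τ := by
    refine LinearMap.ext fun x => ?_
    simp [← mul_assoc, MonoidAlgebra.single_mul_single]

/-- The irreducible representation `V_μ`, by left multiplication. -/
def spechtRep (k : Type*) [Field k] {μ : YoungDiagram} {d : ℕ} (T : μ.cells ≃ Fin d) :
    Representation k (Equiv.Perm (Fin d)) (spechtModule k T) :=
  (regRep k d).subrepresentation (spechtModule k T) fun σ x hx => by
    obtain ⟨y, rfl⟩ := hx
    exact ⟨MonoidAlgebra.single σ 1 * y, by simp [regRep, mul_assoc]⟩

/-! ### The module of covariants -/

/-- `M_μ = Hom_{S_d}(V_μ, A)`. -/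
abbrev CovariantModule (k : Type*) [Field k] (n : ℕ) {μ : YoungDiagram} {d : ℕ}
    (T : μ.cells ≃ Fin d) : Type _ :=
  Representation.IntertwiningMap (spechtRep k T) (permRepA k d n)

/-- The action of `GL(U)` on `M_μ`, by composition with its action on `A`. -/
def covariantRep (k : Type*) [Field k] (n : ℕ) {μ : YoungDiagram} {d : ℕ}
    (T : μ.cells ≃ Fin d) :
    Representation k (Matrix.GeneralLinearGroup (Fin (n + 1)) k) (CovariantModule k n T) where
  toFun g := Representation.IntertwiningMap.llcomp (spechtRep k T) (permRepA k d n) (permRepA k d n)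
    ⟨glRepA k d n g, fun σ => glRepA_permRepA_comm k d n g σ⟩
  map_one' := by
    refine LinearMap.ext fun f => Representation.IntertwiningMap.ext ?_
    refine LinearMap.ext fun v => ?_
    change glRepA k d n 1 (f v) = f v
    simp
  map_mul' g h := by
    refine LinearMap.ext fun f => Representation.IntertwiningMap.ext ?_
    refine LinearMap.ext fun v => ?_
    change glRepA k d n (g * h) (f v) = glRepA k d n g (glRepA k d n h (f v))
    simp

/-- The degree `m` component of `M_μ`: the equivariant maps with values in the degree `m` component
of `A`. -/
def covariantPiece (k : Type*) [Field k] (n : ℕ) {μ : YoungDiagram} {d : ℕ}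
    (T : μ.cells ≃ Fin d) (m : ℕ) : Subrepresentation (covariantRep k n T) where
  toSubmodule :=
    { carrier := {f | ∀ v, f v ∈ LinearMap.range (DirectSum.lof k ℕ (fun m => segrePiece k d n m) m)}
      add_mem' := fun hf hg v => Submodule.add_mem _ (hf v) (hg v)
      zero_mem' := fun _ => Submodule.zero_mem _
      smul_mem' := fun c _ hf v => Submodule.smul_mem _ c (hf v) }
  apply_mem_toSubmodule g f hf v := by
    obtain ⟨x, hx⟩ := hf v
    refine ⟨glRepPiece k d n m g x, ?_⟩
    change _ = glRepA k d n g (f v)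
    rw [← hx]
    simp [glRepA, Representation.directSum]

theorem segrePiece_finite (k : Type*) [Field k] (d n m : ℕ) :
    Module.Finite k (segrePiece k d n m) := by
  have hle : segrePiece k d n m ≤ MvPolynomial.restrictDegree (Fin d × Fin (n + 1)) k m := by
    intro p hp
    rw [MvPolynomial.mem_restrictDegree]
    intro s hs q
    have hw := congrFun (hp (MvPolynomial.mem_support_iff.mp hs)) q.1
    rw [Finsupp.weight_apply, Finsupp.sum, Finset.sum_apply] at hw
    by_cases hq : q ∈ s.support
    · rw [← hw]
      refine le_trans ?_ (Finset.single_le_sum (fun _ _ => Nat.zero_le _) hq)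
      simp [multiWeight]
    · simp [Finsupp.notMem_support_iff.mp hq]
  have : Module.Finite k (MvPolynomial.restrictDegree (Fin d × Fin (n + 1)) k m) := inferInstance
  exact Submodule.finiteDimensional_of_le hle

/-- The components of `M_μ` are finite-dimensional, so that the dimensions below are genuine. -/
theorem covariantPiece_finite (k : Type*) [Field k] (n : ℕ) {μ : YoungDiagram} {d : ℕ}
    (T : μ.cells ≃ Fin d) (m : ℕ) : Module.Finite k (covariantPiece k n T m).toSubmodule := by
  have := segrePiece_finite k d n m
  let F : (covariantPiece k n T m).toSubmodule →ₗ[k] (spechtModule k T →ₗ[k] segrePiece k d n m) :=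
    { toFun := fun f => DirectSum.component k ℕ _ m ∘ₗ f.1.toLinearMap
      map_add' := fun f g => by ext; rfl
      map_smul' := fun c f => by ext; rfl }
  have hF : Function.Injective F := by
    intro f g h
    refine Subtype.ext (Representation.IntertwiningMap.ext (LinearMap.ext fun v => ?_))
    obtain ⟨x, hx⟩ := f.2 v
    obtain ⟨y, hy⟩ := g.2 v
    have h1 := LinearMap.congr_fun h v
    change DirectSum.component k ℕ _ m (f.1 v) = DirectSum.component k ℕ _ m (g.1 v) at h1
    change f.1 v = g.1 v
    rw [← hx, ← hy] at h1 ⊢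
    simp only [DirectSum.component.lof_self] at h1
    rw [h1]
  exact Module.Finite.of_injective F hF

/-! ### Characters and the equivariant Hilbert series for `dim U = 2` -/

/-- The element `diag(t₁, t₂)` of the maximal torus of `GL₂`. -/
def torusElt {k : Type*} [Field k] (t₁ t₂ : kˣ) : Matrix.GeneralLinearGroup (Fin (1 + 1)) k where
  val := Matrix.diagonal ![(t₁ : k), (t₂ : k)]
  inv := Matrix.diagonal ![((t₁⁻¹ : kˣ) : k), ((t₂⁻¹ : kˣ) : k)]
  val_inv := by
    rw [Matrix.diagonal_mul_diagonal, ← Matrix.diagonal_one]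
    congr 1
    funext i
    fin_cases i <;> simp
  inv_val := by
    rw [Matrix.diagonal_mul_diagonal, ← Matrix.diagonal_one]
    congr 1
    funext i
    fin_cases i <;> simp

/-- The weight space `L_{i,j}`: vectors on which `(t₁, t₂)` acts as `t₁^i t₂^j`. -/
def weightSpace {k : Type*} [Field k] {L : Type*} [AddCommMonoid L] [Module k L]
    (ρ : Representation k (Matrix.GeneralLinearGroup (Fin (1 + 1)) k) L) (i j : ℕ) :
    Submodule k L where
  carrier := {v | ∀ t₁ t₂ : kˣ, ρ (torusElt t₁ t₂) v = ((t₁ : k) ^ i * (t₂ : k) ^ j) • v}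
  add_mem' hv hw t₁ t₂ := by rw [map_add, hv t₁ t₂, hw t₁ t₂, smul_add]
  zero_mem' t₁ t₂ := by rw [map_zero, smul_zero]
  smul_mem' c v hv t₁ t₂ := by rw [map_smul, hv t₁ t₂, smul_comm]

/-- The character `∑_{i=0}^e dim(L_{i,e-i}) q^i` of a polynomial representation `L` of `GL₂` of
degree `e`. -/
def character {k : Type*} [Field k] {L : Type*} [AddCommMonoid L] [Module k L] (e : ℕ)
    (ρ : Representation k (Matrix.GeneralLinearGroup (Fin (1 + 1)) k) L) : Polynomial ℤ :=
  ∑ i ∈ Finset.range (e + 1),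
    (Module.finrank k (weightSpace ρ i (e - i)) : Polynomial ℤ) * Polynomial.X ^ i

/-- The equivariant Hilbert series `∑_m ch((M_μ)_m) t^m` in `ℤ[q]⟦t⟧`; here `(M_μ)_m` is a polynomial
representation of degree `d * m`. -/
def equivariantHilbertSeries (k : Type*) [Field k] {μ : YoungDiagram} {d : ℕ}
    (T : μ.cells ≃ Fin d) : PowerSeries (Polynomial ℤ) :=
  PowerSeries.mk fun m =>
    character (L := (covariantPiece k 1 T m).toSubmodule) (d * m)
      (covariantPiece k 1 T m).toRepresentation

/-! ### Tableaux and Schur polynomials -/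

/-- Semistandard tableaux of shape `μ` with entries in `{0, …, N - 1}`. -/
abbrev BoundedSSYT (μ : YoungDiagram) (N : ℕ) : Type :=
  {T : SemistandardYoungTableau μ // ∀ c : μ.cells, T c.1.1 c.1.2 < N}

instance (μ : YoungDiagram) (N : ℕ) : Finite (BoundedSSYT μ N) := by
  refine Finite.of_injective
    (fun (T : BoundedSSYT μ N) (c : μ.cells) => (⟨T.1 c.1.1 c.1.2, T.2 c⟩ : Fin N)) ?_
  intro T T' h
  refine Subtype.ext (SemistandardYoungTableau.ext fun i j => ?_)
  by_cases hc : (i, j) ∈ μ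
  · exact congrArg Fin.val (congrFun h ⟨(i, j), (YoungDiagram.mem_cells (μ := μ) (i, j)).mpr hc⟩)
  · rw [T.1.zeros hc, T'.1.zeros hc]

instance (μ : YoungDiagram) (N : ℕ) : Fintype (BoundedSSYT μ N) := Fintype.ofFinite _

/-- The Schur polynomial `s_μ(x_0, …, x_{N-1}) = ∑_T ∏_c x_{T(c)}`. -/
def schurPolynomial (μ : YoungDiagram) (N : ℕ) : MvPolynomial (Fin N) ℤ :=
  ∑ T : BoundedSSYT μ N, ∏ c : μ.cells, MvPolynomial.X ⟨T.1 c.1.1 c.1.2, T.2 c⟩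

/-- `s_μ(1, q, …, q^m)`. -/
def principalSchur (μ : YoungDiagram) (m : ℕ) : Polynomial ℤ :=
  MvPolynomial.aeval (fun i : Fin (m + 1) => (Polynomial.X : Polynomial ℤ) ^ (i : ℕ))
    (schurPolynomial μ (m + 1))

/-- Standard Young tableaux of shape `μ`: bijective fillings by `1, …, |μ|` that increase along rows
and columns. -/
abbrev StandardTableau (μ : YoungDiagram) : Type :=
  {T : μ.cells ≃ Finset.Icc 1 μ.card //
    (∀ c c' : μ.cells, c.1.1 = c'.1.1 → c.1.2 < c'.1.2 → T c < T c') ∧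
    (∀ c c' : μ.cells, c.1.2 = c'.1.2 → c.1.1 < c'.1.1 → T c < T c')}

instance (μ : YoungDiagram) : Fintype (StandardTableau μ) := Fintype.ofFinite _

open Classical in
/-- The descents of `T`: those `i` for which `i + 1` appears in a lower row than `i`. -/
def descents {μ : YoungDiagram} (T : StandardTableau μ) : Finset ℕ :=
  {i ∈ Finset.Icc 1 μ.card | ∃ c c' : μ.cells,
    (T.1 c : ℕ) = i ∧ (T.1 c' : ℕ) = i + 1 ∧ c.1.1 < c'.1.1}

/-- The number of descents. -/
def des {μ : YoungDiagram} (T : StandardTableau μ) : ℕ := (descents T).card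

/-- The major index: the sum of the descents. -/
def maj {μ : YoungDiagram} (T : StandardTableau μ) : ℕ := ∑ i ∈ descents T, i

end

end Covariants

namespace Covariants

noncomputable section

/-! ### Group algebra preliminaries -/

/-! Write `c` for the Young symmetrizer. Since `V_λ = k[S_d] c`, a covariant is determined by its
value at `c`. Von Neumann regularity of the group algebra shows that these values fill exactly `c
A_m`, and the identification respects torus weights (`range_evalGen`). A monomial of `A_m` picks
some `u_0^v u_1^(m-v)` in each tensor factor, so it is a filling of the cells of `λ` by numbers `v ≤
m`. Thus a weight space of `(M_λ)_m` is the image under `c` of a span of fillings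
(`finrank_weightSpace`). Such an image has the vectors `c F`, for `F` semistandard, as a basis
(`finrank_map_supported`). They span by Garnir straightening (`symmVec_mem_of_garnir`,
`symmVec_mem_span`). They are independent because their expansions are triangular with respect to
the lexicographic order on row sums (`linearIndependent_symmVec`). Counting semistandard fillings by
weight gives `s_λ(1, q, …, q^m)`.

For the second equality, recording the exponent of `u_1` instead of `u_0` yields the same character,
so an entry `v` may be weighted by `q^(m-v)` instead of `q^v` (`principalSchur_eq_reverse`). A
semistandard tableau with entries at most `m` amounts to its standardization `T` together with gaps
`l_0, …, l_d ≥ 0` of sum `m`, where `l_j ≥ 1` at every descent `j` of `T` (`gaps_injective`,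
`exists_gaps`). Its reversed weight is `∑ j l_j` (`sum_sub_gapValue`). Summing over `m` therefore
gives, for each `T`, a product of geometric series: `q^j t / (1 - q^j t)` at the descents and `1 /
(1 - q^j t)` at the other `j`. The numerators multiply to `t^des q^maj`. -/

open Classical in
/-- The sum of the elements of a subset of a finite group, weighted by a sign character. -/
def charSum (k : Type*) [Field k] {G : Type*} [Group G] [Fintype G] (χ : G →* ℤˣ) (H : Set G) :
    MonoidAlgebra k G :=
  ∑ σ with σ ∈ H, MonoidAlgebra.single σ (((χ σ : ℤˣ) : ℤ) : k)

theorem charSum_mul_single {k : Type*} [Field k] {G : Type*} [Group G] [Fintype G] (χ : G →* ℤˣ)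
    {H : Set G} {h : G} (hH : ∀ σ, σ * h ∈ H ↔ σ ∈ H) :
    charSum k χ H * MonoidAlgebra.single h (((χ h : ℤˣ) : ℤ) : k) = charSum k χ H := by
  classical
  rw [charSum, Finset.sum_mul]
  refine Finset.sum_bijective (· * h) (Group.mulRight_bijective h) (by simp [hH]) ?_
  intro σ _
  simp [MonoidAlgebra.single_mul_single]

theorem single_mul_charSum {k : Type*} [Field k] {G : Type*} [Group G] [Fintype G] (χ : G →* ℤˣ)
    {H : Set G} {h : G} (hH : ∀ σ, h * σ ∈ H ↔ σ ∈ H) :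
    MonoidAlgebra.single h (((χ h : ℤˣ) : ℤ) : k) * charSum k χ H = charSum k χ H := by
  classical
  rw [charSum, Finset.mul_sum]
  refine Finset.sum_bijective (h * ·) (Group.mulLeft_bijective h) (by simp [hH]) ?_
  intro σ _
  simp [MonoidAlgebra.single_mul_single]

/-- The group algebra of a finite group in characteristic zero is von Neumann regular. -/
theorem exists_mul_mul_eq_self {k : Type*} [Field k] [CharZero k] {G : Type*} [Group G] [Finite G]
    (c : MonoidAlgebra k G) : ∃ y, c * y * c = c := by
  -- Maschke: the left ideal generated by `c` has a complement `q`. Writing `1 = y c + f` with `f`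
  -- in `q` and multiplying by `c` on the left puts `c - c y c` in both summands.
  obtain ⟨q, hq⟩ := exists_isCompl (Submodule.span (MonoidAlgebra k G) {c})
  have h1 : (1 : MonoidAlgebra k G) ∈ Submodule.span (MonoidAlgebra k G) {c} ⊔ q := by
    rw [hq.sup_eq_top]; trivial
  obtain ⟨e, he, f, hf, hef⟩ := Submodule.mem_sup.mp h1
  obtain ⟨y, rfl⟩ := Submodule.mem_span_singleton.mp he
  refine ⟨y, ?_⟩
  have h2 : c * f = c - c * y * c := by
    have := congrArg (c * ·) hef
    simp only [mul_add, mul_one, smul_eq_mul, ← mul_assoc] at this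
    exact eq_sub_of_add_eq' this
  have h3 : c - c * y * c ∈ q := h2 ▸ q.smul_mem c hf
  have h4 : c - c * y * c ∈ Submodule.span (MonoidAlgebra k G) {c} :=
    Submodule.mem_span_singleton.mpr ⟨1 - c * y, by simp [sub_mul]⟩
  have h5 := Submodule.disjoint_def.mp hq.disjoint _ h4 h3
  exact (sub_eq_zero.mp h5).symm

/-! ### Row and column groups -/

variable {μ : YoungDiagram} {d : ℕ}

/-- The row of the cell carrying a given number. -/
def cellRow (T : μ.cells ≃ Fin d) (z : Fin d) : ℕ := (T.symm z).1.1

/-- The column of the cell carrying a given number. -/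
def cellCol (T : μ.cells ≃ Fin d) (z : Fin d) : ℕ := (T.symm z).1.2

theorem cell_mem (T : μ.cells ≃ Fin d) (z : Fin d) : (cellRow T z, cellCol T z) ∈ μ :=
  (YoungDiagram.mem_cells _).mp (T.symm z).2

theorem cell_injective (T : μ.cells ≃ Fin d) {z z' : Fin d} (hr : cellRow T z = cellRow T z')
    (hc : cellCol T z = cellCol T z') : z = z' :=
  T.symm.injective (Subtype.ext (Prod.ext hr hc))

theorem exists_cell (T : μ.cells ≃ Fin d) {i j : ℕ} (h : (i, j) ∈ μ) :
    ∃ z, cellRow T z = i ∧ cellCol T z = j :=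
  ⟨T ⟨(i, j), (YoungDiagram.mem_cells _).mpr h⟩, by simp [cellRow], by simp [cellCol]⟩

theorem mem_rowGroup {T : μ.cells ≃ Fin d} {σ : Equiv.Perm (Fin d)} :
    σ ∈ rowGroup T ↔ ∀ z, cellRow T (σ z) = cellRow T z := Iff.rfl

theorem mem_colGroup {T : μ.cells ≃ Fin d} {σ : Equiv.Perm (Fin d)} :
    σ ∈ colGroup T ↔ ∀ z, cellCol T (σ z) = cellCol T z := Iff.rfl

/-- The permutations preserving the fibres of a function are closed under multiplication by one of
them, on either side. -/
theorem mul_mem_fiberwise {α β : Type*} {f : α → β} {h : Equiv.Perm α} (hh : ∀ z, f (h z) = f z)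
    (σ : Equiv.Perm α) :
    ((∀ z, f ((σ * h) z) = f z) ↔ ∀ z, f (σ z) = f z) ∧
      ((∀ z, f ((h * σ) z) = f z) ↔ ∀ z, f (σ z) = f z) := by
  refine ⟨⟨fun H z => ?_, fun H z => ?_⟩, ⟨fun H z => ?_, fun H z => ?_⟩⟩
  · have h1 := H (h.symm z)
    have h2 := hh (h.symm z)
    simp only [Equiv.Perm.mul_apply, Equiv.apply_symm_apply] at h1 h2
    rw [h1, h2]
  · rw [Equiv.Perm.mul_apply, H, hh]
  · have h1 := H z
    rwa [Equiv.Perm.mul_apply, hh] at h1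
  · rw [Equiv.Perm.mul_apply, hh, H]

theorem youngSymmetrizer_eq (k : Type*) [Field k] (T : μ.cells ≃ Fin d) :
    youngSymmetrizer k T = charSum k 1 (rowGroup T) * charSum k Equiv.Perm.sign (colGroup T) := by
  simp [youngSymmetrizer, charSum]

/-! ### Fillings and the straightening relations -/

/-- The permutation representation on the span of all fillings `Fin d → ℕ`. -/
def fillingRep (k : Type*) [Field k] (d : ℕ) :
    Representation k (Equiv.Perm (Fin d)) ((Fin d → ℕ) →₀ k) where
  toFun σ := Finsupp.lmapDomain k k fun F => F ∘ σ.symm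
  map_one' := by ext F : 2; simp; rfl
  map_mul' σ τ := by ext F : 2; simp; rfl

theorem fillingRep_single {k : Type*} [Field k] (σ : Equiv.Perm (Fin d)) (F : Fin d → ℕ) (a : k) :
    fillingRep k d σ (Finsupp.single F a) = Finsupp.single (F ∘ σ.symm) a := by
  simp [fillingRep]

/-- The Young symmetrizer applied to a filling. -/
def symmVec (k : Type*) [Field k] (T : μ.cells ≃ Fin d) (F : Fin d → ℕ) : (Fin d → ℕ) →₀ k :=
  (fillingRep k d).asAlgebraHom (youngSymmetrizer k T) (Finsupp.single F 1)

theorem asAlgebraHom_mul_single {k : Type*} [Field k] (x : MonoidAlgebra k (Equiv.Perm (Fin d)))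
    (σ : Equiv.Perm (Fin d)) (a : k) (F : Fin d → ℕ) :
    (fillingRep k d).asAlgebraHom (x * MonoidAlgebra.single σ a) (Finsupp.single F 1) =
      a • (fillingRep k d).asAlgebraHom x (Finsupp.single (F ∘ σ.symm) 1) := by
  rw [map_mul, Module.End.mul_apply, Representation.asAlgebraHom_single, LinearMap.smul_apply,
    fillingRep_single, map_smul]

theorem youngSymmetrizer_mul_single {k : Type*} [Field k] (T : μ.cells ≃ Fin d)
    {τ : Equiv.Perm (Fin d)} (hτ : τ ∈ colGroup T) :
    youngSymmetrizer k T * MonoidAlgebra.single τ (((Equiv.Perm.sign τ : ℤˣ) : ℤ) : k) =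
      youngSymmetrizer k T := by
  rw [youngSymmetrizer_eq, mul_assoc, charSum_mul_single]
  exact fun σ => (mul_mem_fiberwise (f := cellCol T) hτ σ).1

theorem symm_mem_colGroup {T : μ.cells ≃ Fin d} {τ : Equiv.Perm (Fin d)} (hτ : τ ∈ colGroup T) :
    τ.symm ∈ colGroup T := fun z => by
  have := hτ (τ.symm z)
  rw [Equiv.apply_symm_apply] at this
  exact this.symm

/-- The column sum is the right-hand factor of the symmetrizer, so it absorbs column permutations up
to sign before the row sum acts. -/
theorem symmVec_comp {k : Type*} [Field k] (T : μ.cells ≃ Fin d)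
    {τ : Equiv.Perm (Fin d)} (hτ : τ ∈ colGroup T) (F : Fin d → ℕ) :
    symmVec k T F = (((Equiv.Perm.sign τ : ℤˣ) : ℤ) : k) • symmVec k T (F ∘ τ) := by
  have h := asAlgebraHom_mul_single (youngSymmetrizer k T) τ.symm
    (((Equiv.Perm.sign τ.symm : ℤˣ) : ℤ) : k) F
  rw [youngSymmetrizer_mul_single T (symm_mem_colGroup hτ)] at h
  simpa [symmVec, Equiv.Perm.sign_symm] using h

/-- The transposition of the two equal entries fixes the filling but changes the sign of its image,
so the image equals its own negative. -/
theorem symmVec_eq_zero {k : Type*} [Field k] [CharZero k] (T : μ.cells ≃ Fin d) {F : Fin d → ℕ}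
    {z z' : Fin d} (hne : z ≠ z') (hcol : cellCol T z = cellCol T z') (hF : F z = F z') :
    symmVec k T F = 0 := by
  have hτ : Equiv.swap z z' ∈ colGroup T := fun w => by
    rw [Equiv.swap_apply_def]
    split_ifs with h1 h2
    · subst h1; exact hcol.symm
    · subst h2; exact hcol
    · rfl
  have hFs : F ∘ Equiv.swap z z' = F := by
    funext w
    rw [Function.comp_apply, Equiv.swap_apply_def]
    split_ifs with h1 h2
    · rw [h1, hF]
    · rw [h2, hF]
    · rfl
  have h := symmVec_comp (k := k) T hτ F
  rw [hFs, Equiv.Perm.sign_swap hne] at h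
  simp only [Units.val_neg, Units.val_one, Int.cast_neg, Int.cast_one, neg_smul, one_smul] at h
  exact self_eq_neg.mp h

/-- The Garnir relation in the group algebra. -/
theorem youngSymmetrizer_mul_charSum {k : Type*} [Field k] [CharZero k] (T : μ.cells ≃ Fin d)
    (Z : Set (Fin d)) (hZ : ∀ τ ∈ colGroup T, ∃ z ∈ Z, ∃ z' ∈ Z, z ≠ z' ∧
      cellRow T (τ z) = cellRow T (τ z')) :
    youngSymmetrizer k T * charSum k Equiv.Perm.sign {σ | ∀ z, z ∉ Z → σ z = z} = 0 := by
  classical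
  rw [youngSymmetrizer_eq, mul_assoc]
  set G := charSum k Equiv.Perm.sign {σ | ∀ z, z ∉ Z → σ z = z} with hG
  set a := charSum k 1 (rowGroup T) with ha_def
  rw [charSum, Finset.sum_mul, Finset.mul_sum]
  -- Each summand `a τ G` vanishes by itself. The transposition of `z` and `z'` is absorbed by `G`
  -- with a sign, while its conjugate by `τ` is a row permutation, absorbed by `a` without one.
  refine Finset.sum_eq_zero fun τ hτ => ?_
  rw [Finset.mem_filter] at hτ
  obtain ⟨z, hz, z', hz', hne, hrow⟩ := hZ τ hτ.2
  have hswap : MonoidAlgebra.single (Equiv.swap z z') (-1 : k) * G = G := by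
    have := single_mul_charSum (k := k) Equiv.Perm.sign
      (H := {σ : Equiv.Perm (Fin d) | ∀ z, z ∉ Z → σ z = z}) (h := Equiv.swap z z') ?_
    · simpa [Equiv.Perm.sign_swap hne] using this
    · intro σ
      have hfix : ∀ w, w ∉ Z → Equiv.swap z z' w = w := fun w hw =>
        Equiv.swap_apply_of_ne_of_ne (by rintro rfl; exact hw hz) (by rintro rfl; exact hw hz')
      refine forall₂_congr fun w hw => ?_
      rw [Equiv.Perm.mul_apply, Equiv.swap_apply_eq_iff, hfix w hw]
  have hrowmem : Equiv.swap (τ z) (τ z') ∈ rowGroup T := fun w => by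
    rw [Equiv.swap_apply_def]
    split_ifs with h1 h2
    · subst h1; exact hrow.symm
    · subst h2; exact hrow
    · rfl
  have ha : a * MonoidAlgebra.single (Equiv.swap (τ z) (τ z')) 1 = a := by
    have := charSum_mul_single (k := k) 1 (H := rowGroup T) (h := Equiv.swap (τ z) (τ z'))
      (fun σ => (mul_mem_fiberwise (f := cellRow T) hrowmem σ).1)
    simpa using this
  set s : k := (((Equiv.Perm.sign τ : ℤˣ) : ℤ) : k)
  have hconj : Equiv.swap (τ z) (τ z') * τ = τ * Equiv.swap z z' :=
    (Equiv.mul_swap_eq_swap_mul τ z z').symm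
  have key : a * (MonoidAlgebra.single τ s * G) = -(a * (MonoidAlgebra.single τ s * G)) :=
    calc a * (MonoidAlgebra.single τ s * G)
        = a * (MonoidAlgebra.single (Equiv.swap (τ z) (τ z')) 1 * MonoidAlgebra.single τ s * G) := by
          conv_lhs => rw [← ha]
          simp only [mul_assoc]
      _ = -(a * (MonoidAlgebra.single τ s * (MonoidAlgebra.single (Equiv.swap z z') (-1) * G))) := by
          rw [MonoidAlgebra.single_mul_single, hconj, ← mul_assoc (MonoidAlgebra.single τ s),
            MonoidAlgebra.single_mul_single]
          simp [MonoidAlgebra.single_neg]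
      _ = -(a * (MonoidAlgebra.single τ s * G)) := by rw [hswap]
  have h2 : (2 : k) • (a * (MonoidAlgebra.single τ s * G)) = 0 := by
    rw [two_smul]
    nth_rewrite 1 [key]
    exact neg_add_cancel _
  exact (smul_eq_zero.mp h2).resolve_left two_ne_zero

theorem sum_symmVec_eq_zero {k : Type*} [Field k] [CharZero k] (T : μ.cells ≃ Fin d)
    (Z : Set (Fin d)) (hZ : ∀ τ ∈ colGroup T, ∃ z ∈ Z, ∃ z' ∈ Z, z ≠ z' ∧
      cellRow T (τ z) = cellRow T (τ z')) (F : Fin d → ℕ)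
    (HZ : Finset (Equiv.Perm (Fin d))) (hHZ : ∀ σ, σ ∈ HZ ↔ ∀ z, z ∉ Z → σ z = z) :
    ∑ σ ∈ HZ, (((Equiv.Perm.sign σ : ℤˣ) : ℤ) : k) • symmVec k T (F ∘ σ) = 0 := by
  classical
  have h := congrArg (fun x => (fillingRep k d).asAlgebraHom x (Finsupp.single F 1))
    (youngSymmetrizer_mul_charSum (k := k) T Z hZ)
  simp only [charSum, Finset.mul_sum, map_sum, LinearMap.sum_apply, asAlgebraHom_mul_single,
    map_zero, LinearMap.zero_apply] at h
  rw [← h]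
  -- The group acts by `F ∘ σ⁻¹`, so the sum is reindexed by inverses; signs are unaffected.
  refine Finset.sum_bijective (·⁻¹) (Equiv.inv _).bijective ?_ ?_
  · intro σ
    simp only [hHZ, Finset.mem_filter, Finset.mem_univ, true_and, Set.mem_ofPred_eq]
    refine forall₂_congr fun w hw => ?_
    rw [Equiv.Perm.inv_eq_iff_eq]
    exact eq_comm
  · intro σ _
    simp [symmVec]
    rfl

/-! ### Semistandard fillings span -/

/-- The filling of `Fin d` given by a semistandard tableau. -/
def filling (T : μ.cells ≃ Fin d) (S : SemistandardYoungTableau μ) : Fin d → ℕ :=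
  fun z => S (cellRow T z) (cellCol T z)

theorem exists_filling_eq (T : μ.cells ≃ Fin d) {F : Fin d → ℕ}
    (hrow : ∀ z z', cellRow T z = cellRow T z' → cellCol T z < cellCol T z' → F z ≤ F z')
    (hcol : ∀ z z', cellCol T z = cellCol T z' → cellRow T z < cellRow T z' → F z < F z') :
    ∃ S, filling T S = F := by
  classical
  have hval : ∀ i j, ∃ v, (∀ z, cellRow T z = i → cellCol T z = j → F z = v) ∧
      ((i, j) ∉ μ → v = 0) := by
    intro i j
    by_cases h : (i, j) ∈ μ
    · obtain ⟨z, rfl, rfl⟩ := exists_cell T h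
      exact ⟨F z, fun z' h1 h2 => by rw [cell_injective T h1 h2], fun h' => absurd h h'⟩
    · exact ⟨0, fun z h1 h2 => absurd (h1 ▸ h2 ▸ cell_mem T z) h, fun _ => rfl⟩
  choose E hE hE0 using hval
  -- A `SemistandardYoungTableau` is a function on all of `ℕ × ℕ` that must vanish off the diagram,
  -- hence the default value `0` in `E`.
  refine ⟨⟨E, ?_, ?_, fun h => hE0 _ _ h⟩, ?_⟩
  · intro i j1 j2 hj h
    obtain ⟨z, h1, h2⟩ := exists_cell T h
    obtain ⟨z', h1', h2'⟩ := exists_cell T (μ.up_left_mem le_rfl hj.le h)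
    rw [← hE _ _ z h1 h2, ← hE _ _ z' h1' h2']
    exact hrow _ _ (h1'.trans h1.symm) (by omega)
  · intro i1 i2 j hi h
    obtain ⟨z, h1, h2⟩ := exists_cell T h
    obtain ⟨z', h1', h2'⟩ := exists_cell T (μ.up_left_mem hi.le le_rfl h)
    rw [← hE _ _ z h1 h2, ← hE _ _ z' h1' h2']
    exact hcol _ _ (h2'.trans h2.symm) (by omega)
  · funext z
    exact (hE _ _ z rfl rfl).symm

/-- The rearrangement inequality on `Z`: oppositely ordered families minimise the sum of products,
and equality holds only for rearrangements that are still oppositely ordered. Outside `Z` nothing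
changes. -/
theorem sum_mul_lt_sum_mul_comp {f g : Fin d → ℕ} {Z : Finset (Fin d)} {σ : Equiv.Perm (Fin d)}
    (hσ : ∀ z, z ∉ Z → σ z = z) (h : AntivaryOn f g Z) (hn : ¬ AntivaryOn f (g ∘ σ) Z) :
    ∑ z, f z * g z < ∑ z, f z * g (σ z) := by
  rw [← Finset.sum_add_sum_compl Z, ← Finset.sum_add_sum_compl Z fun z => f z * g (σ z)]
  refine add_lt_add_of_lt_of_le ?_ (le_of_eq ?_)
  · refine (h.sum_mul_lt_sum_mul_comp_perm_iff fun z hz => ?_).mpr hn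
    by_contra h'
    exact hz (hσ z h')
  · refine Finset.sum_congr rfl fun z hz => ?_
    rw [hσ z (Finset.mem_compl.mp hz)]

/-- Every filling can be sorted within columns. -/
theorem exists_colGroup_sorted (T : μ.cells ≃ Fin d) (F : Fin d → ℕ) :
    ∃ τ ∈ colGroup T, ∀ z z', cellCol T z = cellCol T z' → cellRow T z < cellRow T z' →
      F (τ z) ≤ F (τ z') := by
  classical
  have hone : (1 : Equiv.Perm (Fin d)) ∈ colGroup T := fun z => rfl
  -- A maximiser of this sum is sorted, since swapping an inverted pair in a column would increase
  -- it.
  obtain ⟨τ, hτ, hmax⟩ := Finset.exists_max_image (Finset.univ.filter (· ∈ colGroup T))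
    (fun τ => ∑ z, cellRow T z * F (τ z)) ⟨1, by simpa using hone⟩
  have hτ' : τ ∈ colGroup T := by simpa using hτ
  refine ⟨τ, hτ', fun z z' hc hr => ?_⟩
  by_contra! hlt
  have hne : z ≠ z' := by rintro rfl; exact lt_irrefl _ hr
  have hs : Equiv.swap z z' ∈ colGroup T := fun w => by
    rw [Equiv.swap_apply_def]
    split_ifs with h1 h2
    · subst h1; exact hc.symm
    · subst h2; exact hc
    · rfl
  have h1 := hmax (τ * Equiv.swap z z') (by
    simp only [Finset.mem_filter, Finset.mem_univ, true_and]
    exact ((mul_mem_fiberwise (f := cellCol T) hτ' _).2).mpr hs)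
  refine absurd h1 (not_le.mpr ?_)
  refine sum_mul_lt_sum_mul_comp (f := cellRow T) (g := F ∘ τ) (Z := {z, z'})
    (σ := Equiv.swap z z') ?_ ?_ ?_
  · intro w hw
    simp only [Finset.mem_insert, Finset.mem_singleton, not_or] at hw
    exact Equiv.swap_apply_of_ne_of_ne hw.1 hw.2
  · intro a ha b hb hab
    simp only [Finset.coe_insert, Finset.coe_singleton, Set.mem_insert_iff,
      Set.mem_singleton_iff] at ha hb
    rcases ha with rfl | rfl <;> rcases hb with rfl | rfl <;> simp at hab ⊢ <;> omega
  · intro h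
    have := h (i := z) (by simp) (j := z') (by simp) (by simpa using hlt)
    omega

/-- The set of cells used in a Garnir relation meets some row twice, after any column permutation. -/
theorem garnir_pigeonhole (T : μ.cells ≃ Fin d) {z₀ z₁ : Fin d}
    (hrow : cellRow T z₀ = cellRow T z₁) (hcol : cellCol T z₀ < cellCol T z₁)
    {τ : Equiv.Perm (Fin d)} (hτ : τ ∈ colGroup T) :
    ∃ z ∈ {z | (cellCol T z = cellCol T z₀ ∧ cellRow T z₀ ≤ cellRow T z) ∨
        (cellCol T z = cellCol T z₁ ∧ cellRow T z ≤ cellRow T z₀)},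
      ∃ z' ∈ {z | (cellCol T z = cellCol T z₀ ∧ cellRow T z₀ ≤ cellRow T z) ∨
        (cellCol T z = cellCol T z₁ ∧ cellRow T z ≤ cellRow T z₀)},
      z ≠ z' ∧ cellRow T (τ z) = cellRow T (τ z') := by
  classical
  set X := Finset.univ.filter fun z => cellCol T z = cellCol T z₀ ∧ cellRow T z₀ ≤ cellRow T z
    with hX
  set Y := Finset.univ.filter fun z => cellCol T z = cellCol T z₁ ∧ cellRow T z ≤ cellRow T z₀
    with hY
  set L := μ.colLen (cellCol T z₀) with hL
  have hcardX : X.card = (Finset.Ico (cellRow T z₀) L).card := by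
    rw [← Finset.card_image_of_injOn (s := X) (f := cellRow T)]
    · congr 1
      ext r
      simp only [hX, Finset.mem_image, Finset.mem_filter, Finset.mem_univ, true_and,
        Finset.mem_Ico]
      constructor
      · rintro ⟨z, ⟨h1, h2⟩, rfl⟩
        refine ⟨h2, ?_⟩
        rw [hL, ← h1, ← YoungDiagram.mem_iff_lt_colLen]
        exact cell_mem T z
      · rintro ⟨h1, h2⟩
        rw [hL, ← YoungDiagram.mem_iff_lt_colLen] at h2
        obtain ⟨z, h3, h4⟩ := exists_cell T h2
        exact ⟨z, ⟨h4, h3 ▸ h1⟩, h3⟩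
    · intro a ha b hb hab
      simp only [hX, Finset.coe_filter, Set.mem_ofPred_eq, Finset.mem_univ, true_and] at ha hb
      exact cell_injective T hab (ha.1.trans hb.1.symm)
  have hcardY : Y.card = (Finset.range (cellRow T z₀ + 1)).card := by
    rw [← Finset.card_image_of_injOn (s := Y) (f := cellRow T)]
    · congr 1
      ext r
      simp only [hY, Finset.mem_image, Finset.mem_filter, Finset.mem_univ, true_and,
        Finset.mem_range]
      constructor
      · rintro ⟨z, ⟨h1, h2⟩, rfl⟩
        omega
      · intro h1
        obtain ⟨z, h3, h4⟩ := exists_cell T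
          (μ.up_left_mem (i2 := cellRow T z₁) (i1 := r) (by omega) le_rfl (cell_mem T z₁))
        exact ⟨z, ⟨h4, by omega⟩, h3⟩
    · intro a ha b hb hab
      simp only [hY, Finset.coe_filter, Set.mem_ofPred_eq, Finset.mem_univ, true_and] at ha hb
      exact cell_injective T hab (ha.1.trans hb.1.symm)
  have hdisj : Disjoint X Y := by
    rw [Finset.disjoint_left]
    intro z h1 h2
    simp only [hX, hY, Finset.mem_filter, Finset.mem_univ, true_and] at h1 h2
    omega
  have hz₀ : cellRow T z₀ < L := by
    rw [hL, ← YoungDiagram.mem_iff_lt_colLen]; exact cell_mem T z₀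
  -- With `r` the common row of `z₀` and `z₁`, the set has `(L - r) + (r + 1) = L + 1` cells. Only
  -- `L` rows are available to them, because a column further right is no longer than the column of
  -- `z₀`.
  have hlt : (Finset.range L).card < (X ∪ Y).card := by
    rw [Finset.card_union_of_disjoint hdisj, hcardX, hcardY, Nat.card_Ico, Finset.card_range,
      Finset.card_range]
    omega
  obtain ⟨z, hz, z', hz', hne, heq⟩ := Finset.exists_ne_map_eq_of_card_lt_of_maps_to
    (f := fun z => cellRow T (τ z)) hlt (by
      intro z hz
      simp only [hX, hY, Finset.coe_union, Finset.coe_filter, Finset.mem_univ, true_and,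
        Set.mem_union, Set.mem_ofPred_eq] at hz
      rw [Finset.mem_coe, Finset.mem_range, hL, ← YoungDiagram.mem_iff_lt_colLen]
      refine μ.up_left_mem le_rfl ?_ (cell_mem T (τ z))
      have := hτ z
      change cellCol T (τ z) = cellCol T z at this
      omega)
  simp only [hX, hY, Finset.mem_union, Finset.mem_filter, Finset.mem_univ, true_and] at hz hz'
  exact ⟨z, hz, z', hz', hne, heq⟩

/-- The column-weighted sum of entries is the order used for straightening. It ignores sorting
within columns and, by the next lemma, is bounded in terms of the total of the entries. -/
theorem sum_cellCol_mul_comp (T : μ.cells ≃ Fin d) {τ : Equiv.Perm (Fin d)} (hτ : τ ∈ colGroup T)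
    (F : Fin d → ℕ) : ∑ z, cellCol T z * F (τ z) = ∑ z, cellCol T z * F z := by
  rw [← Equiv.sum_comp τ fun z => cellCol T z * F z]
  refine Finset.sum_congr rfl fun z _ => ?_
  rw [show cellCol T (τ z) = cellCol T z from hτ z]

theorem sum_cellCol_mul_le (T : μ.cells ≃ Fin d) (F : Fin d → ℕ) :
    ∑ z, cellCol T z * F z ≤ (∑ z, cellCol T z) * ∑ z, F z := by
  rw [Finset.mul_sum]
  exact Finset.sum_le_sum fun z _ => Nat.mul_le_mul_right _
    (Finset.single_le_sum (f := cellCol T) (fun _ _ => Nat.zero_le _) (Finset.mem_univ z))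

/-- Straightening: a column-strict filling that is not semistandard is a combination of fillings
further up in the order. -/
theorem symmVec_mem_of_garnir {k : Type*} [Field k] [CharZero k] (T : μ.cells ≃ Fin d)
    {F : Fin d → ℕ}
    (hcs : ∀ z z', cellCol T z = cellCol T z' → cellRow T z < cellRow T z' → F z < F z')
    {z₀ z₁ : Fin d} (hrow : cellRow T z₀ = cellRow T z₁) (hcol : cellCol T z₀ < cellCol T z₁)
    (hF : F z₁ < F z₀) {Q : Submodule k ((Fin d → ℕ) →₀ k)}
    (hQ : ∀ σ : Equiv.Perm (Fin d), ∑ z, cellCol T z * F z < ∑ z, cellCol T z * F (σ z) →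
      symmVec k T (F ∘ σ) ∈ Q) : symmVec k T F ∈ Q := by
  classical
  set Z : Finset (Fin d) := Finset.univ.filter fun z =>
    (cellCol T z = cellCol T z₀ ∧ cellRow T z₀ ≤ cellRow T z) ∨
        (cellCol T z = cellCol T z₁ ∧ cellRow T z ≤ cellRow T z₀) with hZ
  have hmemZ : ∀ z, z ∈ Z ↔ (cellCol T z = cellCol T z₀ ∧ cellRow T z₀ ≤ cellRow T z) ∨
        (cellCol T z = cellCol T z₁ ∧ cellRow T z ≤ cellRow T z₀) := by simp [hZ]
  set HZ : Finset (Equiv.Perm (Fin d)) := Finset.univ.filter fun σ => ∀ z, z ∉ Z → σ z = z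
  have hsum := sum_symmVec_eq_zero (k := k) T {z | (cellCol T z = cellCol T z₀ ∧
    cellRow T z₀ ≤ cellRow T z) ∨ (cellCol T z = cellCol T z₁ ∧ cellRow T z ≤ cellRow T z₀)}
    (fun τ hτ => garnir_pigeonhole T hrow hcol hτ) F HZ (by simp [HZ, hmemZ])
  have hlow : ∀ z, cellCol T z = cellCol T z₁ → cellRow T z ≤ cellRow T z₀ → F z ≤ F z₁ := by
    intro z h1 h2
    rcases h2.eq_or_lt with h | h
    · rw [cell_injective T (h.trans hrow) h1]
    · exact (hcs z z₁ h1 (hrow ▸ h)).le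
  have hhigh : ∀ z, cellCol T z = cellCol T z₀ → cellRow T z₀ ≤ cellRow T z → F z₀ ≤ F z := by
    intro z h1 h2
    rcases h2.eq_or_lt with h | h
    · rw [cell_injective T h h1.symm]
    · exact (hcs z₀ z h1.symm h).le
  -- Entries of the left part of `Z` are at least `F z₀ > F z₁`, and those of the right part are at
  -- most `F z₁`.
  have hanti : AntivaryOn (cellCol T) F Z := by
    intro a ha b hb hab
    rw [Finset.mem_coe, hmemZ] at ha hb
    rcases ha with ha | ha <;> rcases hb with hb | hb
    · omega
    · have := hlow b hb.1 hb.2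
      have := hhigh a ha.1 ha.2
      omega
    · omega
    · omega
  rw [← Finset.sum_filter_add_sum_filter_not HZ (· ∈ colGroup T)] at hsum
  -- The terms of the Garnir sum coming from column permutations all equal `symmVec k T F`, so they
  -- add up to a positive multiple of it. The remaining terms should lie further up in the order.
  have h1 : ∑ σ ∈ HZ with σ ∈ colGroup T,
      (((Equiv.Perm.sign σ : ℤˣ) : ℤ) : k) • symmVec k T (F ∘ σ) =
      ((HZ.filter (· ∈ colGroup T)).card : k) • symmVec k T F := by
    rw [Nat.cast_smul_eq_nsmul, ← Finset.sum_const]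
    refine Finset.sum_congr rfl fun σ hσ => ?_
    exact (symmVec_comp T (Finset.mem_filter.mp hσ).2 F).symm
  have hcard : ((HZ.filter (· ∈ colGroup T)).card : k) ≠ 0 := by
    rw [Nat.cast_ne_zero]
    exact Finset.card_ne_zero_of_mem (a := 1) (by simp [HZ, mem_colGroup])
  rw [h1] at hsum
  have h2 : ∑ σ ∈ HZ with σ ∉ colGroup T,
      (((Equiv.Perm.sign σ : ℤˣ) : ℤ) : k) • symmVec k T (F ∘ σ) ∈ Q := by
    refine Q.sum_mem fun σ hσ => Q.smul_mem _ (hQ σ ?_)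
    simp only [HZ, Finset.mem_filter, Finset.mem_univ, true_and] at hσ
    obtain ⟨hσ, hnc⟩ := hσ
    -- It remains to see that a permutation of `Z` keeping columns and entries oppositely ordered
    -- preserves both parts of `Z`.
    refine sum_mul_lt_sum_mul_comp hσ hanti fun hanti' => hnc ?_
    have hmaps : ∀ z ∈ Z, σ z ∈ Z := by
      intro z hz
      by_contra h
      have := hσ _ h
      rw [EmbeddingLike.apply_eq_iff_eq] at this
      exact h (this.symm ▸ hz)
    -- no cell of the left part moves to the right part
    have hsame : ∀ z ∈ Z, cellCol T z = cellCol T z₀ → cellCol T (σ z) = cellCol T z₀ := by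
      intro x hx hxc
      by_contra hne
      have hx' := (hmemZ _).mp (hmaps x hx)
      have hx1 : F (σ x) ≤ F z₁ := by
        rcases hx' with h | h
        · exact absurd h.1 hne
        · exact hlow _ h.1 h.2
      -- some cell of the right part moves to the left part
      have hex : ∃ y ∈ Z, cellCol T y = cellCol T z₁ ∧ cellCol T (σ y) = cellCol T z₀ := by
        by_contra! hno
        -- Otherwise `σ` would map the right part injectively into itself, hence onto itself,
        -- leaving no room for `σ x`.
        set Y := Z.filter fun y => cellCol T y = cellCol T z₁
        have hinj : (Y.image σ).card = Y.card := Finset.card_image_of_injective _ σ.injective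
        have hsub : Y.image σ ⊆ Y := by
          intro w hw
          obtain ⟨y, hy, rfl⟩ := Finset.mem_image.mp hw
          obtain ⟨hyZ, hyc⟩ := Finset.mem_filter.mp hy
          refine Finset.mem_filter.mpr ⟨hmaps y hyZ, ?_⟩
          rcases (hmemZ _).mp (hmaps y hyZ) with h | h
          · exact absurd h.1 (hno y hyZ hyc)
          · exact h.1
        have heq := Finset.eq_of_subset_of_card_le hsub hinj.ge
        have hσx : σ x ∈ Y := Finset.mem_filter.mpr ⟨hmaps x hx, by
          rcases hx' with h | h
          · exact absurd h.1 hne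
          · exact h.1⟩
        rw [← heq, Finset.mem_image] at hσx
        obtain ⟨y, hy, hyx⟩ := hσx
        rw [σ.injective hyx] at hy
        have := (Finset.mem_filter.mp hy).2
        omega
      obtain ⟨y, hy, hyc, hyσ⟩ := hex
      have hy1 : F z₀ ≤ F (σ y) := by
        rcases (hmemZ _).mp (hmaps y hy) with h | h
        · exact hhigh _ h.1 h.2
        · omega
      have := hanti' (i := x) hx (j := y) hy (show F (σ x) < F (σ y) by omega)
      omega
    -- and hence none moves the other way
    intro z
    change cellCol T (σ z) = cellCol T z
    by_cases hz : z ∈ Z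
    · rcases (hmemZ z).mp hz with h | h
      · rw [hsame z hz h.1, h.1]
      · rcases (hmemZ _).mp (hmaps z hz) with h' | h'
        · exfalso
          set X := Z.filter fun y => cellCol T y = cellCol T z₀
          have hinj : (X.image σ).card = X.card := Finset.card_image_of_injective _ σ.injective
          have hsub : X.image σ ⊆ X := by
            intro w hw
            obtain ⟨y, hy, rfl⟩ := Finset.mem_image.mp hw
            obtain ⟨hyZ, hyc⟩ := Finset.mem_filter.mp hy
            exact Finset.mem_filter.mpr ⟨hmaps y hyZ, hsame y hyZ hyc⟩
          have heq := Finset.eq_of_subset_of_card_le hsub hinj.ge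
          have hσz : σ z ∈ X := Finset.mem_filter.mpr ⟨hmaps z hz, h'.1⟩
          rw [← heq, Finset.mem_image] at hσz
          obtain ⟨y, hy, hyz⟩ := hσz
          rw [σ.injective hyz] at hy
          have := (Finset.mem_filter.mp hy).2
          omega
        · rw [h'.1, h.1]
    · rw [hσ z hz]
  have h3 := Q.neg_mem h2
  rw [← eq_neg_of_add_eq_zero_left hsum] at h3
  exact (Submodule.smul_mem_iff Q hcard).mp h3

theorem symmVec_mem_span {k : Type*} [Field k] [CharZero k] (T : μ.cells ≃ Fin d)
    {P : Set (Fin d → ℕ)} (hP : ∀ F ∈ P, ∀ σ : Equiv.Perm (Fin d), F ∘ σ ∈ P) {F : Fin d → ℕ}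
    (hF : F ∈ P) : symmVec k T F ∈ Submodule.span k
      (Set.range fun S : {S : SemistandardYoungTableau μ // filling T S ∈ P} =>
        symmVec k T (filling T S.1)) := by
  -- The induction is on the distance of the column-weighted sum from its bound. The total of the
  -- entries is unchanged by permutations, so straightening shrinks this distance.
  induction hn : (∑ z, cellCol T z) * (∑ z, F z) - ∑ z, cellCol T z * F z
    using Nat.strong_induction_on generalizing F with
  | _ n ih =>
  obtain ⟨τ, hτ, hsort⟩ := exists_colGroup_sorted T F
  rw [symmVec_comp T hτ F]
  refine Submodule.smul_mem _ _ ?_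
  by_cases hcs : ∀ z z', cellCol T z = cellCol T z' → cellRow T z < cellRow T z' →
      (F ∘ τ) z < (F ∘ τ) z'
  · by_cases hrw : ∀ z z', cellRow T z = cellRow T z' → cellCol T z < cellCol T z' →
        (F ∘ τ) z ≤ (F ∘ τ) z'
    · obtain ⟨S, hS⟩ := exists_filling_eq T hrw hcs
      rw [← hS]
      exact Submodule.subset_span ⟨⟨S, hS ▸ hP F hF τ⟩, rfl⟩
    · push Not at hrw
      obtain ⟨z₀, z₁, h0, h1, h2⟩ := hrw
      refine symmVec_mem_of_garnir T hcs h0 h1 h2 fun σ hσ => ?_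
      have hPσ := hP _ (hP F hF τ) σ
      refine ih _ ?_ hPσ rfl
      have hle := sum_cellCol_mul_le T ((F ∘ τ) ∘ σ)
      have e1 : ∑ z, ((F ∘ τ) ∘ σ) z = ∑ z, F z := by
        rw [← Equiv.sum_comp (τ * σ) F]; rfl
      have e2 := sum_cellCol_mul_comp T hτ F
      simp only [Function.comp_apply] at hσ hle e1 ⊢
      rw [e1] at hle ⊢
      rw [← hn]
      omega
  · push Not at hcs
    obtain ⟨z, z', h1, h2, h3⟩ := hcs
    rw [symmVec_eq_zero T (by rintro rfl; exact lt_irrefl _ h2) h1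
      (le_antisymm (hsort z z' h1 h2) h3)]
    exact Submodule.zero_mem _

/-! ### Semistandard fillings are independent -/

/-- The sums of the entries in each row. -/
def rowSums (T : μ.cells ≃ Fin d) (F : Fin d → ℕ) : Lex (ℕ → ℕ) :=
  toLex fun r => ∑ z with cellRow T z = r, F z

theorem rowSums_comp (T : μ.cells ≃ Fin d) {ρ : Equiv.Perm (Fin d)} (hρ : ρ ∈ rowGroup T)
    (F : Fin d → ℕ) : rowSums T (F ∘ ρ) = rowSums T F := by
  refine congrArg toLex (funext fun r => ?_)
  refine Finset.sum_bijective ρ ρ.bijective ?_ fun _ _ => rfl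
  intro z
  simp only [Finset.mem_filter, Finset.mem_univ, true_and]
  rw [show cellRow T (ρ z) = cellRow T z from hρ z]

/-- Take the first row in which `τ` moves a cell. All cells above are fixed, so each moved cell of
that row receives an entry from strictly below it, and that row sum grows while the earlier ones
stay. -/
theorem rowSums_lt (T : μ.cells ≃ Fin d) {F : Fin d → ℕ}
    (hcs : ∀ z z', cellCol T z = cellCol T z' → cellRow T z < cellRow T z' → F z < F z')
    {τ : Equiv.Perm (Fin d)} (hτ : τ ∈ colGroup T) (hne : τ ≠ 1) :
    rowSums T F < rowSums T (F ∘ τ) := by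
  classical
  have hex : ∃ r z, cellRow T z = r ∧ τ z ≠ z := by
    by_contra! h
    exact hne (Equiv.ext fun z => h _ z rfl)
  obtain ⟨z₀, hz₀, hz₀'⟩ := Nat.find_spec hex
  have hmin : ∀ z, cellRow T z < Nat.find hex → τ z = z := by
    intro z hz
    by_contra h
    exact Nat.find_min hex hz ⟨z, rfl, h⟩
  have hup : ∀ z, cellRow T z = Nat.find hex → τ z ≠ z → F z < F (τ z) := by
    intro z hz hne
    refine hcs z (τ z) (hτ z).symm ?_
    by_contra! hle
    rcases hle.lt_or_eq with h | h
    · exact hne (τ.injective (hmin _ (hz ▸ h)))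
    · exact hne (cell_injective T h (hτ z))
  change ∃ i, (∀ r, r < i → (∑ z with cellRow T z = r, F z) =
    ∑ z with cellRow T z = r, F (τ z)) ∧
      (∑ z with cellRow T z = i, F z) < ∑ z with cellRow T z = i, F (τ z)
  refine ⟨Nat.find hex, fun r hr => ?_, ?_⟩
  · refine Finset.sum_congr rfl fun z hz => ?_
    rw [hmin z ((Finset.mem_filter.mp hz).2 ▸ hr)]
  · refine Finset.sum_lt_sum (fun z hz => ?_) ⟨z₀, by simp [hz₀], hup z₀ hz₀ hz₀'⟩
    by_cases h : τ z = z
    · rw [h]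
    · exact (hup z (Finset.mem_filter.mp hz).2 h).le

theorem filling_row_weak (T : μ.cells ≃ Fin d) (S : SemistandardYoungTableau μ) {z z' : Fin d}
    (hr : cellRow T z = cellRow T z') (hc : cellCol T z ≤ cellCol T z') :
    filling T S z ≤ filling T S z' := by
  rw [filling, filling, hr]
  exact S.row_weak_of_le hc (cell_mem T z')

theorem filling_col_strict (T : μ.cells ≃ Fin d) (S : SemistandardYoungTableau μ) (z z' : Fin d)
    (hc : cellCol T z = cellCol T z') (hr : cellRow T z < cellRow T z') :
    filling T S z < filling T S z' := by
  rw [filling, filling, hc]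
  exact S.col_strict hr (cell_mem T z')

theorem filling_injective (T : μ.cells ≃ Fin d) : Function.Injective (filling T) := by
  intro S S' h
  refine SemistandardYoungTableau.ext fun i j => ?_
  by_cases hc : (i, j) ∈ μ
  · obtain ⟨z, rfl, rfl⟩ := exists_cell T hc
    exact congrFun h z
  · rw [S.zeros hc, S'.zeros hc]

/-- A weakly increasing row is determined by its multiset of entries. If the entry `v` of `S'` at
`z` exceeded that of `S`, the row would have more entries below `v` in `S` than in `S'`. -/
theorem filling_comp_le (T : μ.cells ≃ Fin d) {S S' : SemistandardYoungTableau μ}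
    {ρ : Equiv.Perm (Fin d)} (hρ : ρ ∈ rowGroup T) (h : filling T S' = filling T S ∘ ρ)
    (z : Fin d) : filling T S' z ≤ filling T S z := by
  classical
  by_contra! hlt
  set v := filling T S' z
  set A := Finset.univ.filter fun w => cellRow T w = cellRow T z ∧ filling T S w < v
  set A' := Finset.univ.filter fun w => cellRow T w = cellRow T z ∧ filling T S' w < v
  have hcard : A'.card = A.card := by
    refine Finset.card_bijective ρ ρ.bijective fun w => ?_
    simp only [A, A', Finset.mem_filter, Finset.mem_univ, true_and]
    rw [show cellRow T (ρ w) = cellRow T w from hρ w, h]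
    rfl
  have hss : A' ⊂ A := by
    refine Finset.ssubset_iff_subset_ne.mpr ⟨fun w hw => ?_, fun heq => ?_⟩
    · simp only [A, A', Finset.mem_filter, Finset.mem_univ, true_and] at hw ⊢
      refine ⟨hw.1, lt_of_le_of_lt (filling_row_weak T S hw.1 ?_) hlt⟩
      by_contra! hcol
      exact absurd (filling_row_weak T S' hw.1.symm hcol.le) (not_le.mpr hw.2)
    · have hz : z ∈ A := by simp [A, hlt]
      rw [← heq] at hz
      simp [A', v] at hz
  exact absurd hcard (Finset.card_lt_card hss).ne

theorem eq_of_filling_comp (T : μ.cells ≃ Fin d) {S S' : SemistandardYoungTableau μ}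
    {ρ : Equiv.Perm (Fin d)} (hρ : ρ ∈ rowGroup T) (h : filling T S' = filling T S ∘ ρ) :
    S' = S := by
  refine filling_injective T (funext fun z => le_antisymm (filling_comp_le T hρ h z) ?_)
  refine filling_comp_le T (ρ := ρ.symm) (fun w => ?_) ?_ z
  · have := hρ (ρ.symm w)
    rw [Equiv.apply_symm_apply] at this
    exact this.symm
  · rw [h]
    funext w
    simp

open Classical in
theorem symmVec_apply {k : Type*} [Field k] (T : μ.cells ≃ Fin d) (F F' : Fin d → ℕ) :
    symmVec k T F F' = ∑ ρ with ρ ∈ rowGroup T, ∑ τ with τ ∈ colGroup T,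
      if (F ∘ τ) ∘ ρ = F' then (((Equiv.Perm.sign τ : ℤˣ) : ℤ) : k) else 0 := by
  have hinv : ∀ {σ : Equiv.Perm (Fin d)}, σ ∈ rowGroup T → σ.symm ∈ rowGroup T := by
    intro σ hσ w
    have := hσ (σ.symm w)
    rw [Equiv.apply_symm_apply] at this
    exact this.symm
  rw [symmVec, youngSymmetrizer_eq, charSum, charSum]
  simp only [Finset.sum_mul, Finset.mul_sum, map_sum, LinearMap.sum_apply,
    asAlgebraHom_mul_single, Finsupp.coe_finsetSum, Finset.sum_apply]
  rw [Finset.sum_comm]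
  refine Finset.sum_bijective (·⁻¹) (Equiv.inv _).bijective ?_ fun ρ _ => ?_
  · intro ρ
    simp only [Finset.mem_filter, Finset.mem_univ, true_and]
    exact ⟨fun h => hinv h, fun h => hinv h⟩
  refine Finset.sum_bijective (·⁻¹) (Equiv.inv _).bijective ?_ fun τ _ => ?_
  · intro τ
    simp only [Finset.mem_filter, Finset.mem_univ, true_and]
    exact ⟨fun h => symm_mem_colGroup h, fun h => symm_mem_colGroup h⟩
  rw [Representation.asAlgebraHom_single, LinearMap.smul_apply, fillingRep_single]
  simp [Finsupp.single_apply]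

/-- Triangularity: a nontrivial column permutation raises the row sums strictly, and a row
permutation alone cannot lead to a different semistandard filling. -/
theorem eq_or_rowSums_lt {k : Type*} [Field k] (T : μ.cells ≃ Fin d)
    {S S' : SemistandardYoungTableau μ} (h : symmVec k T (filling T S) (filling T S') ≠ 0) :
    S' = S ∨ rowSums T (filling T S) < rowSums T (filling T S') := by
  classical
  rw [symmVec_apply] at h
  obtain ⟨ρ, hρ, h⟩ := Finset.exists_ne_zero_of_sum_ne_zero h
  obtain ⟨τ, hτ, h⟩ := Finset.exists_ne_zero_of_sum_ne_zero h
  simp only [Finset.mem_filter, Finset.mem_univ, true_and] at hρ hτ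
  have heq : (filling T S ∘ τ) ∘ ρ = filling T S' := by
    by_contra h'
    exact h (if_neg h')
  by_cases h1 : τ = 1
  · subst h1
    exact Or.inl (eq_of_filling_comp T hρ heq.symm)
  · right
    rw [← heq, rowSums_comp T hρ]
    exact rowSums_lt T (filling_col_strict T S) hτ h1

/-- Only the trivial column permutation contributes, so the coefficient is the number of row
permutations fixing the filling, which is nonzero in characteristic `0`. -/
theorem symmVec_self_ne_zero {k : Type*} [Field k] [CharZero k] (T : μ.cells ≃ Fin d)
    (S : SemistandardYoungTableau μ) : symmVec k T (filling T S) (filling T S) ≠ 0 := by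
  classical
  rw [symmVec_apply]
  have h : ∀ ρ ∈ Finset.univ.filter (· ∈ rowGroup T), (∑ τ with τ ∈ colGroup T,
      if (filling T S ∘ τ) ∘ ρ = filling T S then (((Equiv.Perm.sign τ : ℤˣ) : ℤ) : k) else 0) =
      if filling T S ∘ ρ = filling T S then 1 else 0 := by
    intro ρ hρ
    rw [Finset.sum_eq_single_of_mem 1 (by simp [mem_colGroup])]
    · simp
    · intro τ hτ hne
      refine if_neg fun heq => ?_
      have hlt := rowSums_lt T (filling_col_strict T S) (Finset.mem_filter.mp hτ).2 hne
      rw [← rowSums_comp T (Finset.mem_filter.mp hρ).2 (filling T S ∘ τ), heq] at hlt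
      exact lt_irrefl _ hlt
  rw [Finset.sum_congr rfl h, Finset.sum_ite, Finset.sum_const_zero, add_zero, Finset.sum_const,
    nsmul_one, Nat.cast_ne_zero]
  exact Finset.card_ne_zero_of_mem (a := 1) (by simp [mem_rowGroup])

theorem linearIndependent_symmVec {k : Type*} [Field k] [CharZero k] (T : μ.cells ≃ Fin d) :
    LinearIndependent k fun S : SemistandardYoungTableau μ => symmVec k T (filling T S) := by
  classical
  rw [linearIndependent_iff']
  intro s g hg
  by_contra! h
  obtain ⟨S₁, hS₁, hne₁⟩ := h
  -- At the filling of a tableau with least row sums, no other term of the relation has a nonzero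
  -- coefficient.
  obtain ⟨S₀, hS₀, hmin⟩ := Finset.exists_min_image (s.filter (g · ≠ 0))
    (fun S => rowSums T (filling T S)) ⟨S₁, by simp [hS₁, hne₁]⟩
  rw [Finset.mem_filter] at hS₀
  have h := DFunLike.congr_fun hg (filling T S₀)
  rw [Finsupp.finsetSum_apply, Finset.sum_eq_single_of_mem S₀ hS₀.1] at h
  · rw [Finsupp.smul_apply, smul_eq_mul, Finsupp.zero_apply] at h
    exact (mul_ne_zero hS₀.2 (symmVec_self_ne_zero T S₀)) h
  · intro S hS hne
    rw [Finsupp.smul_apply, smul_eq_mul]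
    by_cases hgS : g S = 0
    · rw [hgS, zero_mul]
    by_cases hv : symmVec k T (filling T S) (filling T S₀) = 0
    · rw [hv, mul_zero]
    rcases eq_or_rowSums_lt T hv with h | h
    · exact absurd h.symm hne
    · exact absurd h (not_lt.mpr (hmin S (by simp [hS, hgS])))

/-- The image of the Young symmetrizer on an invariant span of fillings has dimension the number of
semistandard tableaux. -/
theorem finrank_map_supported {k : Type*} [Field k] [CharZero k] (T : μ.cells ≃ Fin d)
    {P : Set (Fin d → ℕ)} (hP : ∀ F ∈ P, ∀ σ : Equiv.Perm (Fin d), F ∘ σ ∈ P) :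
    Module.finrank k ((Finsupp.supported k k P).map
      ((fillingRep k d).asAlgebraHom (youngSymmetrizer k T))) =
      Nat.card {S : SemistandardYoungTableau μ // filling T S ∈ P} := by
  have hspan : (Finsupp.supported k k P).map
      ((fillingRep k d).asAlgebraHom (youngSymmetrizer k T)) = Submodule.span k
      (Set.range fun S : {S : SemistandardYoungTableau μ // filling T S ∈ P} =>
        symmVec k T (filling T S.1)) := by
    rw [Finsupp.supported_eq_span_single, Submodule.map_span]
    refine le_antisymm (Submodule.span_le.mpr ?_) (Submodule.span_mono ?_)
    · rintro _ ⟨_, ⟨F, hF, rfl⟩, rfl⟩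
      exact symmVec_mem_span T hP hF
    · rintro _ ⟨S, rfl⟩
      exact ⟨_, ⟨filling T S.1, S.2, rfl⟩, rfl⟩
  rw [hspan]
  have hli := (linearIndependent_symmVec (k := k) T).comp
    (Subtype.val : {S : SemistandardYoungTableau μ // filling T S ∈ P} → _) Subtype.val_injective
  exact Module.finrank_eq_nat_card_basis (Module.Basis.span hli)

/-! ### Weight spaces of the module of covariants -/

/-- Exponents of the monomials of weight `(i, d * m - i)` in `(Sym^m U)^{⊗ d}`. -/
def weightExponents (d m i : ℕ) : Set (Fin d × Fin (1 + 1) →₀ ℕ) :=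
  {s | (∀ z, s (z, 0) + s (z, 1) = m) ∧ ∑ z, s (z, 0) = i}

theorem coeff_glSubst_torusElt {k : Type*} [Field k] (t₁ t₂ : kˣ) (p : CoordRing k d 1)
    (s : Fin d × Fin (1 + 1) →₀ ℕ) :
    MvPolynomial.coeff s (glSubst ((torusElt t₁ t₂ : Matrix.GeneralLinearGroup (Fin (1 + 1)) k) :
      Matrix (Fin (1 + 1)) (Fin (1 + 1)) k) p) =
      ((t₁ : k) ^ (∑ z, s (z, 0)) * (t₂ : k) ^ (∑ z, s (z, 1))) * MvPolynomial.coeff s p := by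
  classical
  induction p using MvPolynomial.induction_on' with
  | add p q hp hq => rw [map_add, MvPolynomial.coeff_add, hp, hq, MvPolynomial.coeff_add, mul_add]
  | monomial e a =>
    have hX : ∀ q : Fin d × Fin (1 + 1), (∑ l, MvPolynomial.C (((torusElt t₁ t₂ :
        Matrix.GeneralLinearGroup (Fin (1 + 1)) k) : Matrix (Fin (1 + 1)) (Fin (1 + 1)) k) l q.2) *
        MvPolynomial.X (q.1, l) : CoordRing k d 1) =
        MvPolynomial.C ((![(t₁ : k), (t₂ : k)] : Fin 2 → k) q.2) * MvPolynomial.X q := by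
      rintro ⟨z, j⟩
      simp only [torusElt, Matrix.diagonal_apply]
      rw [Finset.sum_eq_single_of_mem j (Finset.mem_univ _)]
      · simp
      · intro b _ hb
        simp [hb]
    have h1 : glSubst ((torusElt t₁ t₂ : Matrix.GeneralLinearGroup (Fin (1 + 1)) k) :
        Matrix (Fin (1 + 1)) (Fin (1 + 1)) k) (MvPolynomial.monomial e a) =
        MvPolynomial.C ((t₁ : k) ^ (∑ z, e (z, 0)) * (t₂ : k) ^ (∑ z, e (z, 1))) *
          MvPolynomial.monomial e a := by
      rw [glSubst, MvPolynomial.aeval_monomial, MvPolynomial.algebraMap_eq]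
      simp only [hX, mul_pow]
      rw [Finsupp.prod_mul, MvPolynomial.monomial_eq]
      have h2 : (e.prod fun q n => (MvPolynomial.C ((![(t₁ : k), (t₂ : k)] : Fin 2 → k) q.2) :
          CoordRing k d 1) ^ n) =
          MvPolynomial.C ((t₁ : k) ^ (∑ z, e (z, 0)) * (t₂ : k) ^ (∑ z, e (z, 1))) := by
        rw [Finsupp.prod_fintype _ _ (by simp), Fintype.prod_prod_type]
        simp [Finset.prod_mul_distrib, Finset.prod_pow_eq_pow_sum, Fin.prod_univ_two]
      rw [h2]
      ring
    rw [h1, MvPolynomial.coeff_C_mul, MvPolynomial.coeff_monomial]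
    split_ifs with h
    · rw [h]
    · simp

theorem mem_restrictSupport_of_torus {k : Type*} [Field k] [CharZero k] {m i j : ℕ}
    {p : CoordRing k d 1} (hp : p ∈ segrePiece k d 1 m)
    (h : ∀ t₁ t₂ : kˣ, glRep k d 1 (torusElt t₁ t₂) p = ((t₁ : k) ^ i * (t₂ : k) ^ j) • p) :
    p ∈ MvPolynomial.restrictSupport k (weightExponents d m i) := by
  rw [MvPolynomial.mem_restrictSupport_iff]
  intro s hs
  have hs' := MvPolynomial.mem_support_iff.mp (Finset.mem_coe.mp hs)
  refine ⟨fun z => ?_, ?_⟩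
  · have hw := congrFun (hp hs') z
    rw [Finsupp.weight_apply, Finsupp.sum_fintype _ _ (by simp), Finset.sum_apply,
      Fintype.sum_prod_type] at hw
    simpa [multiWeight, Pi.single_apply, Fin.sum_univ_two, Finset.sum_add_distrib] using hw
  -- The single torus element `diag(2, 1)` already separates the exponents of `u_0`, since powers of
  -- `2` are distinct in characteristic `0`.
  · have h1 := congrArg (MvPolynomial.coeff s) (h (Units.mk0 2 two_ne_zero) 1)
    have h2 := coeff_glSubst_torusElt (Units.mk0 (2 : k) two_ne_zero) 1 p s
    change MvPolynomial.coeff s (glRep k d 1 _ p) = _ at h2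
    rw [h2, MvPolynomial.coeff_smul, smul_eq_mul] at h1
    have h3 := mul_right_cancel₀ hs' h1
    simp only [Units.val_one, one_pow, mul_one, Units.val_mk0] at h3
    have h4 : (2 : ℕ) ^ (∑ z, s (z, 0)) = 2 ^ i := by exact_mod_cast h3
    exact Nat.pow_right_injective le_rfl h4

theorem glRep_torusElt_of_mem {k : Type*} [Field k] {m i : ℕ} {p : CoordRing k d 1}
    (hp : p ∈ MvPolynomial.restrictSupport k (weightExponents d m i)) (t₁ t₂ : kˣ) :
    glRep k d 1 (torusElt t₁ t₂) p = ((t₁ : k) ^ i * (t₂ : k) ^ (d * m - i)) • p := by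
  rw [MvPolynomial.mem_restrictSupport_iff] at hp
  refine MvPolynomial.ext _ _ fun s => ?_
  refine (coeff_glSubst_torusElt t₁ t₂ p s).trans ?_
  rw [MvPolynomial.coeff_smul, smul_eq_mul]
  by_cases hs : MvPolynomial.coeff s p = 0
  · rw [hs, mul_zero, mul_zero]
  · obtain ⟨h1, h2⟩ := hp (Finset.mem_coe.mpr (MvPolynomial.mem_support_iff.mpr hs))
    have h3 : ∑ z, s (z, 0) + ∑ z, s (z, 1) = d * m := by
      rw [← Finset.sum_add_distrib, Finset.sum_congr rfl fun z _ => h1 z]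
      simp
    rw [h2] at h3 ⊢
    rw [show ∑ z, s (z, 1) = d * m - i by omega]

theorem restrictSupport_le_segrePiece {k : Type*} [Field k] {m i : ℕ} :
    MvPolynomial.restrictSupport k (weightExponents d m i) ≤ segrePiece k d 1 m := by
  intro p hp s hs
  rw [MvPolynomial.mem_restrictSupport_iff] at hp
  obtain ⟨h1, -⟩ := hp (Finset.mem_coe.mpr (MvPolynomial.mem_support_iff.mpr hs))
  funext z
  rw [Finsupp.weight_apply, Finsupp.sum_fintype _ _ (by simp), Finset.sum_apply,
      Fintype.sum_prod_type]
  simpa [multiWeight, Pi.single_apply, Fin.sum_univ_two, Finset.sum_add_distrib] using h1 z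

/-- Equivariant linear maps are linear over the group algebra. -/
theorem map_asAlgebraHom {k G V W : Type*} [Field k] [Group G] [AddCommMonoid V] [Module k V]
    [AddCommMonoid W] [Module k W] {ρ : Representation k G V} {σ : Representation k G W}
    (φ : V →ₗ[k] W) (hφ : ∀ g v, φ (ρ g v) = σ g (φ v)) (y : MonoidAlgebra k G) (v : V) :
    φ (ρ.asAlgebraHom y v) = σ.asAlgebraHom y (φ v) := by
  induction y using MonoidAlgebra.induction_linear with
  | zero => simp
  | add x y hx hy => simp only [map_add, LinearMap.add_apply, hx, hy]
  | single g a => simp [Representation.asAlgebraHom_single, hφ]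

theorem coe_asAlgebraHom_spechtRep {k : Type*} [Field k] (T : μ.cells ≃ Fin d)
    (y : MonoidAlgebra k (Equiv.Perm (Fin d))) (v : spechtModule k T) :
    (((spechtRep k T).asAlgebraHom y v : spechtModule k T) :
      MonoidAlgebra k (Equiv.Perm (Fin d))) = y * v := by
  have h1 := map_asAlgebraHom (ρ := spechtRep k T) (σ := regRep k d) (spechtModule k T).subtype
    (fun g v => rfl) y v
  refine h1.trans ?_
  clear h1
  induction y using MonoidAlgebra.induction_linear with
  | zero => simp
  | add x y hx hy => simp only [map_add, LinearMap.add_apply, add_mul, hx, hy]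
  | single g a =>
    rw [Representation.asAlgebraHom_single]
    simp [regRep, ← smul_mul_assoc]

/-- The Young symmetrizer as an element of the Specht module. -/
def spechtGen (k : Type*) [Field k] (T : μ.cells ≃ Fin d) : spechtModule k T :=
  ⟨youngSymmetrizer k T, 1, by simp⟩

theorem spechtModule_eq {k : Type*} [Field k] (T : μ.cells ≃ Fin d) (v : spechtModule k T) :
    ∃ y, v = (spechtRep k T).asAlgebraHom y (spechtGen k T) := by
  obtain ⟨v, y, rfl⟩ := v
  exact ⟨y, Subtype.ext (coe_asAlgebraHom_spechtRep T y (spechtGen k T)).symm⟩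

theorem asAlgebraHom_permRepA_lof {k : Type*} [Field k] {n m : ℕ}
    (y : MonoidAlgebra k (Equiv.Perm (Fin d))) (x : segrePiece k d n m) :
    (permRepA k d n).asAlgebraHom y (DirectSum.lof k ℕ (fun m => segrePiece k d n m) m x) =
      DirectSum.lof k ℕ (fun m => segrePiece k d n m) m
        ((permRepPiece k d n m).asAlgebraHom y x) :=
  (map_asAlgebraHom (DirectSum.lof k ℕ (fun m => segrePiece k d n m) m)
    (fun g v => by simp [permRepA, Representation.directSum]) y x).symm

theorem coe_asAlgebraHom_permRepPiece {k : Type*} [Field k] {n m : ℕ}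
    (y : MonoidAlgebra k (Equiv.Perm (Fin d))) (x : segrePiece k d n m) :
    ((permRepPiece k d n m).asAlgebraHom y x : CoordRing k d n) =
      (permRep k d n).asAlgebraHom y x :=
  map_asAlgebraHom (segrePiece k d n m).subtype (fun _ _ => rfl) y x

theorem glRepA_lof {k : Type*} [Field k] {n m : ℕ}
    (g : Matrix.GeneralLinearGroup (Fin (n + 1)) k) (x : segrePiece k d n m) :
    glRepA k d n g (DirectSum.lof k ℕ (fun m => segrePiece k d n m) m x) =
      DirectSum.lof k ℕ (fun m => segrePiece k d n m) m (glRepPiece k d n m g x) := by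
  simp [glRepA, Representation.directSum]

/-- Evaluation of a covariant of degree `m` at the Young symmetrizer. -/
def evalGen (k : Type*) [Field k] (T : μ.cells ≃ Fin d) (m i j : ℕ) :
    weightSpace (covariantPiece k 1 T m).toRepresentation i j →ₗ[k] CoordRing k d 1 where
  toFun f := (DirectSum.component k ℕ (fun m => segrePiece k d 1 m) m (f.1.1 (spechtGen k T))).1
  map_add' _ _ := rfl
  map_smul' _ _ := rfl

theorem lof_evalGen {k : Type*} [Field k] (T : μ.cells ≃ Fin d) {m i j : ℕ}
    (f : weightSpace (covariantPiece k 1 T m).toRepresentation i j) (v : spechtModule k T) :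
    ∃ x, f.1.1 v = DirectSum.lof k ℕ (fun m => segrePiece k d 1 m) m x := by
  obtain ⟨x, hx⟩ := f.1.2 v
  exact ⟨x, hx.symm⟩

/-- The Young symmetrizer generates the Specht module, and covariants of degree `m` take values in
degree `m`, so projecting to that component loses nothing. -/
theorem evalGen_injective {k : Type*} [Field k] (T : μ.cells ≃ Fin d) (m i j : ℕ) :
    Function.Injective (evalGen k T m i j) := by
  intro f f' hf
  obtain ⟨x, hx⟩ := lof_evalGen T f (spechtGen k T)
  obtain ⟨x', hx'⟩ := lof_evalGen T f' (spechtGen k T)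
  have hf' : (DirectSum.component k ℕ (fun m => segrePiece k d 1 m) m
    (f.1.1 (spechtGen k T))).1 = (DirectSum.component k ℕ (fun m => segrePiece k d 1 m) m
    (f'.1.1 (spechtGen k T))).1 := hf
  rw [hx, hx', DirectSum.component.lof_self, DirectSum.component.lof_self] at hf'
  rw [Subtype.ext hf', ← hx'] at hx
  refine Subtype.ext (Subtype.ext (Representation.IntertwiningMap.ext (LinearMap.ext fun v => ?_)))
  obtain ⟨y, rfl⟩ := spechtModule_eq T v
  refine (map_asAlgebraHom f.1.1.toLinearMap
    (fun g v => Representation.IntertwiningMap.isIntertwining _ _ f.1.1 g v) y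
    (spechtGen k T)).trans ?_
  refine Eq.trans ?_ (map_asAlgebraHom f'.1.1.toLinearMap
    (fun g v => Representation.IntertwiningMap.isIntertwining _ _ f'.1.1 g v) y
    (spechtGen k T)).symm
  exact congrArg _ hx

theorem range_evalGen {k : Type*} [Field k] [CharZero k] (T : μ.cells ≃ Fin d) (m i : ℕ) :
    LinearMap.range (evalGen k T m i (d * m - i)) =
      (MvPolynomial.restrictSupport k (weightExponents d m i)).map
        ((permRep k d 1).asAlgebraHom (youngSymmetrizer k T)) := by
  refine le_antisymm ?_ ?_
  · rintro _ ⟨f, rfl⟩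
    -- From `c = c y c` follows `f(c) = c · f(y c)`, and `f(y c)` inherits the weight of `f`.
    obtain ⟨y, hy⟩ := exists_mul_mul_eq_self (youngSymmetrizer k T)
    have hgen : spechtGen k T = (spechtRep k T).asAlgebraHom (youngSymmetrizer k T)
        ((spechtRep k T).asAlgebraHom y (spechtGen k T)) := by
      refine Subtype.ext ?_
      rw [coe_asAlgebraHom_spechtRep, coe_asAlgebraHom_spechtRep, ← mul_assoc]
      exact hy.symm
    obtain ⟨x, hx⟩ := lof_evalGen T f ((spechtRep k T).asAlgebraHom y (spechtGen k T))
    have h := map_asAlgebraHom f.1.1.toLinearMap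
      (fun g v => Representation.IntertwiningMap.isIntertwining _ _ f.1.1 g v)
      (youngSymmetrizer k T) ((spechtRep k T).asAlgebraHom y (spechtGen k T))
    rw [← hgen] at h
    change f.1.1 (spechtGen k T) = (permRepA k d 1).asAlgebraHom (youngSymmetrizer k T)
      (f.1.1 ((spechtRep k T).asAlgebraHom y (spechtGen k T))) at h
    rw [hx, asAlgebraHom_permRepA_lof] at h
    refine ⟨x.1, mem_restrictSupport_of_torus (i := i) (j := d * m - i) x.2 fun t₁ t₂ => ?_, ?_⟩
    · have hw := congrArg (fun g => g.1 ((spechtRep k T).asAlgebraHom y (spechtGen k T)))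
        (f.2 t₁ t₂)
      change glRepA k d 1 (torusElt t₁ t₂) (f.1.1 _) =
        ((t₁ : k) ^ i * (t₂ : k) ^ (d * m - i)) • (f.1.1 _) at hw
      rw [hx, glRepA_lof, ← map_smul] at hw
      have := congrArg (DirectSum.component k ℕ (fun m => segrePiece k d 1 m) m) hw
      rw [DirectSum.component.lof_self, DirectSum.component.lof_self] at this
      exact congrArg Subtype.val this
    · change _ = (DirectSum.component k ℕ (fun m => segrePiece k d 1 m) m
        (f.1.1 (spechtGen k T))).1
      rw [h, DirectSum.component.lof_self, coe_asAlgebraHom_permRepPiece]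
  · rintro _ ⟨w, hw, rfl⟩
    set x : segrePiece k d 1 m := ⟨w, restrictSupport_le_segrePiece hw⟩
    -- Conversely, `v ↦ v · w` is equivariant on the left ideal and takes the value `c · w` at `c`.
    let φ : spechtModule k T →ₗ[k] SegreRing k d 1 :=
      ((permRepA k d 1).asAlgebraHom.toLinearMap.flip
        (DirectSum.lof k ℕ (fun m => segrePiece k d 1 m) m x)) ∘ₗ (spechtModule k T).subtype
    have hφ : ∀ v : spechtModule k T, φ v = (permRepA k d 1).asAlgebraHom v.1
      (DirectSum.lof k ℕ (fun m => segrePiece k d 1 m) m x) := fun v => rfl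
    let f : CovariantModule k 1 T := ⟨φ, fun σ => LinearMap.ext fun v => by
      change φ (spechtRep k T σ v) = permRepA k d 1 σ (φ v)
      rw [hφ, hφ, show ((spechtRep k T σ v : spechtModule k T) :
        MonoidAlgebra k (Equiv.Perm (Fin d))) = MonoidAlgebra.single σ 1 * v.1 from rfl, map_mul,
        Module.End.mul_apply, Representation.asAlgebraHom_single_one]⟩
    have hf : ∀ v, f v = (permRepA k d 1).asAlgebraHom v.1
      (DirectSum.lof k ℕ (fun m => segrePiece k d 1 m) m x) := fun v => rfl
    have hfm : f ∈ (covariantPiece k 1 T m).toSubmodule := fun v => by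
      rw [hf, asAlgebraHom_permRepA_lof]
      exact ⟨_, rfl⟩
    have hfw : (⟨f, hfm⟩ : (covariantPiece k 1 T m).toSubmodule) ∈
        weightSpace (covariantPiece k 1 T m).toRepresentation i (d * m - i) := by
      intro t₁ t₂
      refine Subtype.ext (Representation.IntertwiningMap.ext (LinearMap.ext fun v => ?_))
      change glRepA k d 1 (torusElt t₁ t₂) (f v) = ((t₁ : k) ^ i * (t₂ : k) ^ (d * m - i)) • f v
      rw [hf, map_asAlgebraHom (σ := permRepA k d 1) (glRepA k d 1 (torusElt t₁ t₂))
        (fun σ v => LinearMap.congr_fun (glRepA_permRepA_comm k d 1 (torusElt t₁ t₂) σ) v),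
        glRepA_lof, ← map_smul, ← map_smul]
      congr 2
      exact Subtype.ext (glRep_torusElt_of_mem hw t₁ t₂)
    refine ⟨⟨⟨f, hfm⟩, hfw⟩, ?_⟩
    change (DirectSum.component k ℕ (fun m => segrePiece k d 1 m) m (f (spechtGen k T))).1 = _
    rw [hf, asAlgebraHom_permRepA_lof, DirectSum.component.lof_self, coe_asAlgebraHom_permRepPiece]
    rfl

/-- The exponent attached to a filling by a pair of functions. -/
def fillingExponent (h : Fin (1 + 1) → ℕ → ℕ) (F : Fin d → ℕ) : Fin d × Fin (1 + 1) →₀ ℕ :=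
  Finsupp.equivFunOnFinite.symm fun q => h q.2 (F q.1)

/-- An entry `v` stands for the monomial `u_0^(h 0 v) u_1^(h 1 v)`. The encoding `h` is left free so
that both `(v, m - v)` and `(m - v, v)` can be used. One injective component suffices, the truncated
`m - v` not being injective on `ℕ`. -/
theorem finrank_weightSpace {k : Type*} [Field k] [CharZero k] (T : μ.cells ≃ Fin d) (m i : ℕ)
    (h : Fin (1 + 1) → ℕ → ℕ) (hinj : ∃ j, Function.Injective (h j)) {P : Set (Fin d → ℕ)}
    (hP : ∀ F ∈ P, ∀ σ : Equiv.Perm (Fin d), F ∘ σ ∈ P)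
    (hPm : fillingExponent h '' P = weightExponents d m i) :
    Module.finrank k (weightSpace (covariantPiece k 1 T m).toRepresentation i (d * m - i)) =
      Nat.card {S : SemistandardYoungTableau μ // filling T S ∈ P} := by
  classical
  rw [← finrank_map_supported (k := k) T hP,
    (LinearEquiv.ofInjective _ (evalGen_injective T m i (d * m - i))).finrank_eq, range_evalGen]
  have hexp : Function.Injective (fillingExponent (d := d) h) := by
    obtain ⟨j, hj⟩ := hinj
    intro F F' hFF
    exact funext fun z => hj (DFunLike.congr_fun hFF (z, j))
  let Φ : ((Fin d → ℕ) →₀ k) →ₗ[k] CoordRing k d 1 :=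
    Finsupp.linearCombination k fun F => MvPolynomial.monomial (fillingExponent h F) (1 : k)
  have hΦ : Function.Injective Φ := by
    have := (MvPolynomial.basisMonomials (Fin d × Fin (1 + 1)) k).linearIndependent.comp _ hexp
    rw [MvPolynomial.coe_basisMonomials] at this
    exact this
  have hΦσ : ∀ (σ : Equiv.Perm (Fin d)) v, Φ (fillingRep k d σ v) = permRep k d 1 σ (Φ v) := by
    intro σ v
    induction v using Finsupp.induction_linear with
    | zero => simp
    | add v w hv hw => simp only [map_add, hv, hw]
    | single F a =>
      rw [fillingRep_single]
      simp only [Φ, Finsupp.linearCombination_single, map_smul]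
      congr 1
      refine Eq.trans ?_ (MvPolynomial.rename_monomial (Prod.map σ id) _ _).symm
      congr 2
      refine Finsupp.ext fun ⟨z, j⟩ => ?_
      have hi : Function.Injective (Prod.map σ (id : Fin (1 + 1) → Fin (1 + 1))) :=
        σ.injective.prodMap Function.injective_id
      have hz : (z, j) = Prod.map σ id (σ.symm z, j) := by simp
      rw [hz, Finsupp.mapDomain_apply hi]
      simp [fillingExponent]
  have hmap : MvPolynomial.restrictSupport k (weightExponents d m i) =
      (Finsupp.supported k k P).map Φ := by
    rw [Finsupp.supported_eq_span_single, Submodule.map_span, ← hPm]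
    refine le_antisymm (fun p hp => ?_) (Submodule.span_le.mpr ?_)
    · rw [MvPolynomial.mem_restrictSupport_iff] at hp
      rw [p.as_sum]
      refine Submodule.sum_mem _ fun s hs => ?_
      obtain ⟨F, hF, rfl⟩ := hp (Finset.mem_coe.mpr hs)
      rw [← mul_one (MvPolynomial.coeff _ p), ← smul_eq_mul, ← MvPolynomial.smul_monomial]
      exact Submodule.smul_mem _ _ (Submodule.subset_span
        ⟨_, ⟨F, hF, rfl⟩, by simp [Φ]⟩)
    · rintro _ ⟨_, ⟨F, hF, rfl⟩, rfl⟩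
      simp only [Φ, Finsupp.linearCombination_single, one_smul, SetLike.mem_coe]
      rw [MvPolynomial.mem_restrictSupport_iff, MvPolynomial.support_monomial]
      simp only [one_ne_zero, if_false, Finset.coe_singleton, Set.singleton_subset_iff]
      exact ⟨F, hF, rfl⟩
  -- As `Φ` is injective and equivariant, it carries the image of the symmetrizer on fillings
  -- isomorphically onto its image on polynomials.
  have hcomm : ((permRep k d 1).asAlgebraHom (youngSymmetrizer k T)) ∘ₗ Φ =
      Φ ∘ₗ (fillingRep k d).asAlgebraHom (youngSymmetrizer k T) :=
    LinearMap.ext fun v => (map_asAlgebraHom Φ hΦσ _ v).symm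
  rw [hmap, ← Submodule.map_comp, hcomm, Submodule.map_comp]
  exact (Submodule.equivMapOfInjective Φ hΦ _).finrank_eq.symm

/-! ### The character of a graded piece -/

theorem sum_cells_eq_sum_filling (T : μ.cells ≃ Fin d) (S : SemistandardYoungTableau μ)
    (w : ℕ → ℕ) : ∑ c : μ.cells, w (S c.1.1 c.1.2) = ∑ z, w (filling T S z) :=
  (Equiv.sum_comp T.symm fun c : μ.cells => w (S c.1.1 c.1.2)).symm

theorem character_covariantPiece {k : Type*} [Field k] [CharZero k] (T : μ.cells ≃ Fin d) (m : ℕ)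
    (h : Fin (1 + 1) → ℕ → ℕ) (hinj : ∃ j, Function.Injective (h j))
    (hsum : ∀ v ≤ m, h 0 v + h 1 v = m)
    (hsurj : ∀ a b, a + b = m → ∃ v ≤ m, h 0 v = a ∧ h 1 v = b) :
    character (L := (covariantPiece k 1 T m).toSubmodule) (d * m)
      (covariantPiece k 1 T m).toRepresentation =
      ∑ S : BoundedSSYT μ (m + 1), (Polynomial.X : Polynomial ℤ) ^
        (∑ c : μ.cells, h 0 (S.1 c.1.1 c.1.2)) := by
  classical
  have hbd : ∀ S : BoundedSSYT μ (m + 1), ∀ z, filling T S.1 z ≤ m := fun S z =>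
    Nat.lt_succ_iff.mp (S.2 (T.symm z))
  have hmaps : ∀ S ∈ (Finset.univ : Finset (BoundedSSYT μ (m + 1))),
      ∑ c : μ.cells, h 0 (S.1 c.1.1 c.1.2) ∈ Finset.range (d * m + 1) := by
    intro S _
    rw [sum_cells_eq_sum_filling T, Finset.mem_range, Nat.lt_succ_iff]
    calc ∑ z, h 0 (filling T S.1 z) ≤ ∑ _z : Fin d, m :=
          Finset.sum_le_sum fun z _ => by have := hsum _ (hbd S z); omega
      _ = d * m := by simp
  rw [character, ← Finset.sum_fiberwise_of_maps_to hmaps]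
  refine Finset.sum_congr rfl fun i _ => ?_
  set P : Set (Fin d → ℕ) := {F | (∀ z, F z ≤ m) ∧ ∑ z, h 0 (F z) = i} with hPdef
  have hP : ∀ F ∈ P, ∀ σ : Equiv.Perm (Fin d), F ∘ σ ∈ P := by
    rintro F ⟨h1, h2⟩ σ
    exact ⟨fun z => h1 _, (Equiv.sum_comp σ fun z => h 0 (F z)).trans h2⟩
  have hPm : fillingExponent h '' P = weightExponents d m i := by
    ext s
    constructor
    · rintro ⟨F, ⟨h1, h2⟩, rfl⟩
      exact ⟨fun z => hsum _ (h1 z), h2⟩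
    · rintro ⟨h1, h2⟩
      choose F hF1 hF2 hF3 using fun z => hsurj _ _ (h1 z)
      refine ⟨F, ⟨hF1, by rw [← h2]; exact Finset.sum_congr rfl fun z _ => hF2 z⟩, ?_⟩
      refine Finsupp.ext fun ⟨z, j⟩ => ?_
      fin_cases j
      · exact hF2 z
      · exact hF3 z
  rw [finrank_weightSpace T m i h hinj hP hPm]
  have hcard : Nat.card {S : SemistandardYoungTableau μ // filling T S ∈ P} =
      (Finset.univ.filter fun S : BoundedSSYT μ (m + 1) =>
        ∑ c : μ.cells, h 0 (S.1 c.1.1 c.1.2) = i).card := by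
    rw [← Fintype.card_subtype, ← Nat.card_eq_fintype_card]
    refine Nat.card_congr ⟨fun S => ⟨⟨S.1, fun c => ?_⟩, ?_⟩, fun S => ⟨S.1.1, ?_, ?_⟩,
      fun _ => rfl, fun _ => rfl⟩
    · have := S.2.1 (T c)
      simp only [filling, cellRow, cellCol, Equiv.symm_apply_apply] at this
      omega
    · rw [sum_cells_eq_sum_filling T]
      exact S.2.2
    · exact hbd S.1
    · rw [← sum_cells_eq_sum_filling T]
      exact S.2
  rw [hcard, Finset.sum_congr rfl fun S hS => by rw [(Finset.mem_filter.mp hS).2],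
    Finset.sum_const, nsmul_eq_mul]

theorem principalSchur_eq (μ : YoungDiagram) (m : ℕ) :
    principalSchur μ m = ∑ S : BoundedSSYT μ (m + 1), (Polynomial.X : Polynomial ℤ) ^
        (∑ c : μ.cells, S.1 c.1.1 c.1.2) := by
  simp [principalSchur, schurPolynomial, Finset.prod_pow_eq_pow_sum]

theorem character_eq_principalSchur {k : Type*} [Field k] [CharZero k] (T : μ.cells ≃ Fin d)
    (m : ℕ) : character (L := (covariantPiece k 1 T m).toSubmodule) (d * m)
      (covariantPiece k 1 T m).toRepresentation = principalSchur μ m := by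
  rw [principalSchur_eq, character_covariantPiece T m ![id, (m - ·)]
    ⟨0, Function.injective_id⟩]
  · rfl
  · intro v hv
    simp
    omega
  · intro a b hab
    refine ⟨a, by omega, rfl, ?_⟩
    simp
    omega

/-- The principal specialization is symmetric under reversing the alphabet. -/
theorem principalSchur_eq_reverse (μ : YoungDiagram) (m : ℕ) :
    principalSchur μ m = ∑ S : BoundedSSYT μ (m + 1), (Polynomial.X : Polynomial ℤ) ^
        (∑ c : μ.cells, (m - S.1 c.1.1 c.1.2)) := by
  have T : μ.cells ≃ Fin μ.card := Fintype.equivFinOfCardEq (by simp [YoungDiagram.card])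
  -- The identity has integer coefficients, so any field of characteristic `0` and any numbering of
  -- the cells will do. Both sides are the same character, read with the two encodings.
  rw [← character_eq_principalSchur (k := ℚ) T m, character_covariantPiece T m ![(m - ·), id]
    ⟨1, Function.injective_id⟩]
  · rfl
  · intro v hv
    simp
    omega
  · intro a b hab
    refine ⟨b, by omega, ?_, rfl⟩
    simp
    omega

/-! ### Standardization -/

theorem StandardTableau.pos_mem (T : StandardTableau μ) (c : μ.cells) :
    1 ≤ (T.1 c : ℕ) ∧ (T.1 c : ℕ) ≤ μ.card :=
  Finset.mem_Icc.mp (T.1 c).2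

theorem StandardTableau.exists_pos (T : StandardTableau μ) {t : ℕ} (h1 : 1 ≤ t)
    (h2 : t ≤ μ.card) : ∃ c, (T.1 c : ℕ) = t :=
  ⟨T.1.symm ⟨t, Finset.mem_Icc.mpr ⟨h1, h2⟩⟩, by simp⟩

theorem StandardTableau.le_of_le (T : StandardTableau μ) {c c' : μ.cells} (hr : c.1.1 ≤ c'.1.1)
    (hc : c.1.2 ≤ c'.1.2) : T.1 c ≤ T.1 c' := by
  have hmem : (c.1.1, c'.1.2) ∈ μ.cells := (YoungDiagram.mem_cells _).mpr
    (μ.up_left_mem hr le_rfl ((YoungDiagram.mem_cells _).mp c'.2))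
  have h1 : T.1 c ≤ T.1 ⟨_, hmem⟩ := by
    rcases hc.eq_or_lt with h | h
    · exact le_of_eq (congrArg T.1 (Subtype.ext (Prod.ext rfl h)))
    · exact (T.2.1 c ⟨_, hmem⟩ rfl h).le
  refine h1.trans ?_
  rcases hr.eq_or_lt with h | h
  · exact le_of_eq (congrArg T.1 (Subtype.ext (Prod.ext h rfl)))
  · exact (T.2.2 ⟨_, hmem⟩ c' rfl h).le

theorem StandardTableau.mem_descents (T : StandardTableau μ) (i : ℕ) :
    i ∈ descents T ↔ ∃ c c' : μ.cells, (T.1 c : ℕ) = i ∧ (T.1 c' : ℕ) = i + 1 ∧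
      c.1.1 < c'.1.1 := by
  rw [descents, Finset.mem_filter, and_iff_right_iff_imp]
  rintro ⟨c, -, rfl, -⟩
  exact (T.1 c).2

theorem StandardTableau.pos_eq_card (T : StandardTableau μ) (c : μ.cells) :
    (T.1 c : ℕ) = (Finset.univ.filter fun c' => T.1 c' ≤ T.1 c).card := by
  have h : (Finset.univ.filter fun c' => T.1 c' ≤ T.1 c).card =
      (Finset.Icc 1 (T.1 c : ℕ)).card := by
    refine Finset.card_bij (fun c' _ => (T.1 c' : ℕ)) ?_ ?_ ?_
    · intro c' hc'
      exact Finset.mem_Icc.mpr ⟨(T.pos_mem c').1, (Finset.mem_filter.mp hc').2⟩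
    · intro a _ b _ hab
      exact T.1.injective (Subtype.ext hab)
    · intro t ht
      rw [Finset.mem_Icc] at ht
      obtain ⟨c', rfl⟩ := T.exists_pos ht.1 (ht.2.trans (T.pos_mem c).2)
      exact ⟨c', by simpa using ht.2, rfl⟩
  rw [h, Nat.card_Icc]
  omega

theorem StandardTableau.ext_of_lt {T T' : StandardTableau μ}
    (h : ∀ c c', T.1 c < T.1 c' ↔ T'.1 c < T'.1 c') : T = T' := by
  refine Subtype.ext (Equiv.ext fun c => Subtype.ext ?_)
  rw [T.pos_eq_card, T'.pos_eq_card]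
  congr 1
  refine Finset.filter_congr fun c' _ => ?_
  rw [← not_lt, ← not_lt, h]

/-- Between two positions without intermediate descents one moves weakly up and strictly right. -/
theorem StandardTableau.of_no_descent (T : StandardTableau μ) {c c' : μ.cells}
    (hlt : T.1 c < T.1 c') (hno : ∀ i ∈ descents T, (T.1 c : ℕ) ≤ i → ¬ i < (T.1 c' : ℕ)) :
    c'.1.1 ≤ c.1.1 ∧ c.1.2 < c'.1.2 := by
  have step : ∀ a b : μ.cells, (T.1 b : ℕ) = (T.1 a : ℕ) + 1 → (T.1 a : ℕ) ∉ descents T →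
      b.1.1 ≤ a.1.1 ∧ a.1.2 < b.1.2 := by
    intro a b hab hnd
    have hr : b.1.1 ≤ a.1.1 := by
      by_contra! h
      exact hnd ((T.mem_descents _).mpr ⟨a, b, rfl, hab, h⟩)
    refine ⟨hr, ?_⟩
    -- A cell weakly above and weakly to the left cannot carry the larger number.
    by_contra! hc
    have : (T.1 b : ℕ) ≤ (T.1 a : ℕ) := T.le_of_le hr hc
    omega
  have key : ∀ n, ∀ b : μ.cells, (T.1 b : ℕ) = (T.1 c : ℕ) + 1 + n →
      (∀ i ∈ descents T, (T.1 c : ℕ) ≤ i → ¬ i < (T.1 b : ℕ)) →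
      b.1.1 ≤ c.1.1 ∧ c.1.2 < b.1.2 := by
    intro n
    induction n with
    | zero =>
      intro b hb hno
      exact step c b hb fun h => hno _ h le_rfl (by omega)
    | succ n ih =>
      intro b hb hno
      obtain ⟨a, ha⟩ := T.exists_pos (t := (T.1 c : ℕ) + 1 + n) (by omega)
        (by have := (T.pos_mem b).2; omega)
      have h1 := ih a ha fun i hi h1 h2 => hno i hi h1 (by omega)
      have h2 := step a b (by omega) fun h => hno _ h (by omega) (by omega)
      omega
  have hlt' : (T.1 c : ℕ) < (T.1 c' : ℕ) := hlt
  exact key ((T.1 c' : ℕ) - (T.1 c : ℕ) - 1) c' (by omega) hno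

/-- The value of the tableau with standardization `T` and gaps `l`. -/
def gapValue (T : StandardTableau μ) (l : ℕ →₀ ℕ) (c : μ.cells) : ℕ :=
  ∑ r ∈ Finset.range (T.1 c : ℕ), l r

theorem gapValue_le (T : StandardTableau μ) (l : ℕ →₀ ℕ) {c c' : μ.cells}
    (h : T.1 c ≤ T.1 c') : gapValue T l c ≤ gapValue T l c' :=
  Finset.sum_le_sum_of_subset (Finset.range_mono h)

/-- A descent between the two positions forces a positive gap. Equal values therefore mean no
descent in between, and then the later cell lies strictly to the right. -/
theorem gapValue_lt_or {T : StandardTableau μ} {l : ℕ →₀ ℕ} (hl : ∀ j ∈ descents T, 1 ≤ l j)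
    {c c' : μ.cells} (h : T.1 c < T.1 c') : gapValue T l c < gapValue T l c' ∨
      gapValue T l c = gapValue T l c' ∧ c'.1.1 ≤ c.1.1 ∧ c.1.2 < c'.1.2 := by
  rcases (gapValue_le T l h.le).lt_or_eq with h1 | h1
  · exact Or.inl h1
  refine Or.inr ⟨h1, T.of_no_descent h fun i hi hi1 hi2 => ?_⟩
  have hlt : gapValue T l c < gapValue T l c' := by
    refine Finset.sum_lt_sum_of_subset (Finset.range_mono h.le) (Finset.mem_range.mpr hi2)
      (by simpa using hi1) (hl i hi) fun _ _ _ => Nat.zero_le _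
  omega

/-- The semistandard tableau with standardization `T` and gaps `l`. -/
def ofGaps (T : StandardTableau μ) (l : ℕ →₀ ℕ) (hl : ∀ j ∈ descents T, 1 ≤ l j) :
    SemistandardYoungTableau μ where
  entry i j := if h : (i, j) ∈ μ.cells then gapValue T l ⟨(i, j), h⟩ else 0
  row_weak' := by
    intro i j1 j2 hj h
    have h2 : (i, j2) ∈ μ.cells := (YoungDiagram.mem_cells _).mpr h
    have h1 : (i, j1) ∈ μ.cells := (YoungDiagram.mem_cells _).mpr (μ.up_left_mem le_rfl hj.le h)
    rw [dif_pos h1, dif_pos h2]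
    exact gapValue_le T l (T.2.1 ⟨_, h1⟩ ⟨_, h2⟩ rfl hj).le
  col_strict' := by
    intro i1 i2 j hi h
    have h2 : (i2, j) ∈ μ.cells := (YoungDiagram.mem_cells _).mpr h
    have h1 : (i1, j) ∈ μ.cells := (YoungDiagram.mem_cells _).mpr (μ.up_left_mem hi.le le_rfl h)
    rw [dif_pos h1, dif_pos h2]
    rcases gapValue_lt_or hl (T.2.2 ⟨_, h1⟩ ⟨_, h2⟩ rfl hi) with h | h
    · exact h
    · exact absurd h.2.2 (lt_irrefl _)
  zeros' h := dif_neg fun h' => h ((YoungDiagram.mem_cells _).mp h')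

theorem ofGaps_apply (T : StandardTableau μ) (l : ℕ →₀ ℕ) (hl : ∀ j ∈ descents T, 1 ≤ l j)
    (c : μ.cells) : ofGaps T l hl c.1.1 c.1.2 = gapValue T l c :=
  dif_pos c.2

/-- The admissible gap sequences for a standard tableau. -/
def gapSet (T : StandardTableau μ) (m : ℕ) : Finset (ℕ →₀ ℕ) :=
  {l ∈ Finset.finsuppAntidiag (Finset.range (μ.card + 1)) m | ∀ j ∈ descents T, 1 ≤ l j}

theorem mem_gapSet {T : StandardTableau μ} {m : ℕ} {l : ℕ →₀ ℕ} :
    l ∈ gapSet T m ↔ (∑ r ∈ Finset.range (μ.card + 1), l r = m ∧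
      l.support ⊆ Finset.range (μ.card + 1)) ∧ ∀ j ∈ descents T, 1 ≤ l j := by
  rw [gapSet, Finset.mem_filter, Finset.mem_finsuppAntidiag]

theorem gapValue_lt {T : StandardTableau μ} {m : ℕ} {l : ℕ →₀ ℕ} (hl : l ∈ gapSet T m)
    (c : μ.cells) : gapValue T l c < m + 1 := by
  rw [Nat.lt_succ_iff, ← (mem_gapSet.mp hl).1.1]
  exact Finset.sum_le_sum_of_subset (Finset.range_mono ((T.pos_mem c).2.trans (Nat.le_succ _)))

/-- The reversed weight of the tableau given by a gap sequence. -/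
theorem sum_sub_gapValue {T : StandardTableau μ} {m : ℕ} {l : ℕ →₀ ℕ} (hl : l ∈ gapSet T m) :
    ∑ c : μ.cells, (m - gapValue T l c) = ∑ r ∈ Finset.range (μ.card + 1), r * l r := by
  have h1 : ∀ c : μ.cells, m - gapValue T l c =
      ∑ r ∈ Finset.range (μ.card + 1), if (T.1 c : ℕ) ≤ r then l r else 0 := by
    intro c
    have h := Finset.sum_filter_add_sum_filter_not (Finset.range (μ.card + 1))
      (fun r => (T.1 c : ℕ) ≤ r) l
    rw [(mem_gapSet.mp hl).1.1] at h
    have h2 : (Finset.range (μ.card + 1)).filter (fun r => ¬ (T.1 c : ℕ) ≤ r) =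
        Finset.range (T.1 c : ℕ) := by
      ext r
      simp only [Finset.mem_filter, Finset.mem_range]
      have := (T.pos_mem c).2
      omega
    rw [h2] at h
    rw [← Finset.sum_filter, gapValue]
    omega
  -- After the sums are exchanged, the gap `l r` is counted once for each of the `r` cells numbered
  -- at most `r`.
  rw [Finset.sum_congr rfl fun c _ => h1 c, Finset.sum_comm]
  refine Finset.sum_congr rfl fun r hr => ?_
  rw [← Finset.sum_filter, Finset.sum_const, smul_eq_mul]
  congr 1
  have h2 : (Finset.univ.filter fun c : μ.cells => (T.1 c : ℕ) ≤ r).card =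
      (Finset.Icc 1 r).card := by
    refine Finset.card_bij (fun c' _ => (T.1 c' : ℕ)) ?_ ?_ ?_
    · intro c' hc'
      exact Finset.mem_Icc.mpr ⟨(T.pos_mem c').1, (Finset.mem_filter.mp hc').2⟩
    · intro a _ b _ hab
      exact T.1.injective (Subtype.ext hab)
    · intro t ht
      rw [Finset.mem_Icc] at ht
      rw [Finset.mem_range] at hr
      obtain ⟨c', rfl⟩ := T.exists_pos ht.1 (by omega)
      exact ⟨c', by simpa using ht.2, rfl⟩
  rw [h2, Nat.card_Icc]
  omega

/-- The values determine the order of the cells, by value and then by column, and so the standard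
tableau. The gaps are then the successive differences of the values. -/
theorem gaps_injective {T T' : StandardTableau μ} {m : ℕ} {l l' : ℕ →₀ ℕ} (hl : l ∈ gapSet T m)
    (hl' : l' ∈ gapSet T' m) (h : ∀ c, gapValue T l c = gapValue T' l' c) : T = T' ∧ l = l' := by
  have mono : ∀ {T T' : StandardTableau μ} {l l' : ℕ →₀ ℕ}, l ∈ gapSet T m → l' ∈ gapSet T' m →
      (∀ c, gapValue T l c = gapValue T' l' c) → ∀ c c', T.1 c < T.1 c' → T'.1 c < T'.1 c' := by
    intro T T' l l' hl hl' h c c' hlt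
    have h1 := gapValue_lt_or (mem_gapSet.mp hl).2 hlt
    by_contra! hle
    rcases hle.lt_or_eq with hlt' | heq
    · have h2 := gapValue_lt_or (mem_gapSet.mp hl').2 hlt'
      rw [← h, ← h] at h2
      omega
    · rw [T'.1.injective heq] at hlt
      exact lt_irrefl _ hlt
  have hT : T = T' := StandardTableau.ext_of_lt fun c c' =>
    ⟨mono hl hl' h c c', mono hl' hl (fun c => (h c).symm) c c'⟩
  subst hT
  refine ⟨rfl, ?_⟩
  rw [mem_gapSet] at hl hl'
  have hpart : ∀ t ≤ μ.card + 1, ∑ r ∈ Finset.range t, l r = ∑ r ∈ Finset.range t, l' r := by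
    intro t ht
    rcases Nat.eq_zero_or_pos t with rfl | h0
    · simp
    rcases ht.eq_or_lt with rfl | hlt
    · rw [hl.1.1, hl'.1.1]
    · obtain ⟨c, rfl⟩ := T.exists_pos h0 (by omega)
      exact h c
  ext r
  by_cases hr : r < μ.card + 1
  · have h1 := hpart (r + 1) hr
    have h2 := hpart r hr.le
    rw [Finset.sum_range_succ, Finset.sum_range_succ, h2] at h1
    omega
  · rw [Finsupp.notMem_support_iff.mp fun h => hr (Finset.mem_range.mp (hl.1.2 h)),
      Finsupp.notMem_support_iff.mp fun h => hr (Finset.mem_range.mp (hl'.1.2 h))]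

/-- Every semistandard tableau has a standardization. -/
theorem exists_standardization (S : SemistandardYoungTableau μ) :
    ∃ T : StandardTableau μ, ∀ c c' : μ.cells, T.1 c < T.1 c' →
      S c.1.1 c.1.2 < S c'.1.1 c'.1.2 ∨
        S c.1.1 c.1.2 = S c'.1.1 c'.1.2 ∧ c.1.2 < c'.1.2 := by
  classical
  -- Equal entries are numbered from left to right. Column strictness makes the key injective, and
  -- the standardization is the rank of the key.
  let key : μ.cells → ℕ ×ₗ ℕ := fun c => toLex (S c.1.1 c.1.2, c.1.2)
  have hkey : ∀ c c', key c < key c' ↔ S c.1.1 c.1.2 < S c'.1.1 c'.1.2 ∨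
      S c.1.1 c.1.2 = S c'.1.1 c'.1.2 ∧ c.1.2 < c'.1.2 := fun c c' => Prod.Lex.toLex_lt_toLex
  have hinj : Function.Injective key := by
    intro c c' h
    have h1 : S c.1.1 c.1.2 = S c'.1.1 c'.1.2 := congrArg (fun x => (ofLex x).1) h
    have h2 : c.1.2 = c'.1.2 := congrArg (fun x => (ofLex x).2) h
    refine Subtype.ext (Prod.ext ?_ h2)
    rcases lt_trichotomy c.1.1 c'.1.1 with h3 | h3 | h3
    · have := S.col_strict h3 ((YoungDiagram.mem_cells (c'.1.1, c'.1.2)).mp c'.2)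
      rw [h2] at h1
      omega
    · exact h3
    · have := S.col_strict h3 ((YoungDiagram.mem_cells (c.1.1, c.1.2)).mp c.2)
      rw [← h2] at h1
      omega
  let pos : μ.cells → Finset.Icc 1 μ.card := fun c =>
    ⟨(Finset.univ.filter fun c' => key c' ≤ key c).card, Finset.mem_Icc.mpr
      ⟨Finset.card_pos.mpr ⟨c, by simp⟩, (Finset.card_le_univ _).trans (by
        simp [YoungDiagram.card])⟩⟩
  have hpos : ∀ c c', key c < key c' → pos c < pos c' := by
    intro c c' h
    refine Finset.card_lt_card (Finset.ssubset_iff_of_subset ?_ |>.mpr ⟨c', by simp, by simpa⟩)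
    intro x hx
    simp only [Finset.mem_filter, Finset.mem_univ, true_and] at hx ⊢
    exact hx.trans h.le
  have hpinj : Function.Injective pos := by
    intro c c' h
    rcases lt_trichotomy (key c) (key c') with h1 | h1 | h1
    · exact absurd h (hpos _ _ h1).ne
    · exact hinj h1
    · exact absurd h (hpos _ _ h1).ne'
  have hbij : Function.Bijective pos :=
    (Fintype.bijective_iff_injective_and_card pos).mpr ⟨hpinj, by simp [YoungDiagram.card]⟩
  refine ⟨⟨Equiv.ofBijective pos hbij, ?_, ?_⟩, ?_⟩
  · intro c c' hr hc
    refine hpos _ _ ((hkey _ _).mpr ?_)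
    have := S.row_weak hc ((YoungDiagram.mem_cells (c'.1.1, c'.1.2)).mp c'.2)
    rw [← hr] at this ⊢
    omega
  · intro c c' hc hr
    refine hpos _ _ ((hkey _ _).mpr (Or.inl ?_))
    rw [hc]
    exact S.col_strict hr ((YoungDiagram.mem_cells (c'.1.1, c'.1.2)).mp c'.2)
  · intro c c' h
    rw [← hkey]
    by_contra! hle
    rcases hle.lt_or_eq with h1 | h1
    · exact absurd h (hpos _ _ h1).le.not_gt
    · rw [hinj h1] at h
      exact lt_irrefl _ h

theorem exists_gaps {m : ℕ} (S : BoundedSSYT μ (m + 1)) :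
    ∃ T : StandardTableau μ, ∃ l ∈ gapSet T m, ∀ c : μ.cells,
      gapValue T l c = S.1 c.1.1 c.1.2 := by
  classical
  obtain ⟨T, hT⟩ := exists_standardization S.1
  have hle : ∀ c c' : μ.cells, T.1 c < T.1 c' → S.1 c.1.1 c.1.2 ≤ S.1 c'.1.1 c'.1.2 := by
    intro c c' h
    have := hT c c' h
    omega
  -- The sequence of values in the order of `T`, with boundary values `0` at position `0` and `m`
  -- after position `μ.card`. These account for the first gap `l 0` and the last gap `l μ.card`.
  obtain ⟨a, ha0, haT, haN⟩ : ∃ a : ℕ → ℕ, a 0 = 0 ∧ (∀ c : μ.cells, a (T.1 c) =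
      S.1 c.1.1 c.1.2) ∧ ∀ t, μ.card < t → a t = m := by
    refine ⟨fun t => if h : t ∈ Finset.Icc 1 μ.card then
      S.1 (T.1.symm ⟨t, h⟩).1.1 (T.1.symm ⟨t, h⟩).1.2 else if t = 0 then 0 else m, ?_, ?_, ?_⟩
    · simp
    · intro c
      beta_reduce
      rw [dif_pos (T.1 c).2]
      simp
    · intro t ht
      beta_reduce
      rw [dif_neg (by simp; omega), if_neg (by omega)]
  have hmono : Monotone a := by
    refine monotone_nat_of_le_succ fun t => ?_
    rcases Nat.eq_zero_or_pos t with rfl | h0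
    · rw [ha0]; exact Nat.zero_le _
    rcases lt_or_ge μ.card t with h1 | h1
    · rw [haN t h1, haN (t + 1) (by omega)]
    obtain ⟨c, hc⟩ := T.exists_pos h0 h1
    rcases h1.eq_or_lt with h2 | h2
    · rw [haN (t + 1) (by omega), ← hc, haT]
      exact Nat.lt_succ_iff.mp (S.2 c)
    · obtain ⟨c', hc'⟩ := T.exists_pos (t := t + 1) (by omega) h2
      rw [← hc', ← hc, haT, haT]
      exact hle c c' (show (T.1 c : ℕ) < T.1 c' by omega)
  set l : ℕ →₀ ℕ := Finsupp.onFinset (Finset.range (μ.card + 1)) (fun r => a (r + 1) - a r) (by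
    intro r hr
    rw [Finset.mem_range]
    by_contra! h
    rw [haN r (by omega), haN (r + 1) (by omega)] at hr
    exact hr (Nat.sub_self _)) with hl
  have hsum : ∀ t, ∑ r ∈ Finset.range t, l r = a t := by
    intro t
    have := Finset.sum_range_tsub hmono t
    rw [ha0, Nat.sub_zero] at this
    exact this
  refine ⟨T, l, mem_gapSet.mpr ⟨⟨?_, Finsupp.support_onFinset_subset⟩, ?_⟩, fun c => ?_⟩
  · rw [hsum, haN _ (Nat.lt_succ_self _)]
  · intro j hj
    obtain ⟨c, c', rfl, h2, h3⟩ := (T.mem_descents j).mp hj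
    change 1 ≤ a ((T.1 c : ℕ) + 1) - a (T.1 c)
    rw [← h2, haT, haT]
    have hlt : T.1 c < T.1 c' := show (T.1 c : ℕ) < T.1 c' by omega
    rcases hT c c' hlt with h | ⟨h, h4⟩
    · omega
    -- Equal values at a descent would put `c'` strictly below and strictly to the right of `c`.
    -- Passing through the cell in the row of `c` and the column of `c'` shows that its value is
    -- larger.
    · have hmem := (YoungDiagram.mem_cells (c'.1.1, c'.1.2)).mp c'.2
      have h5 := S.1.row_weak h4 (μ.up_left_mem h3.le le_rfl hmem)
      have h6 := S.1.col_strict h3 hmem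
      omega
  · rw [gapValue, hsum, haT]

theorem sum_bounded_eq_sum_gaps (μ : YoungDiagram) (m : ℕ) :
    ∑ S : BoundedSSYT μ (m + 1), (Polynomial.X : Polynomial ℤ) ^
        (∑ c : μ.cells, (m - S.1 c.1.1 c.1.2)) =
      ∑ T : StandardTableau μ, ∑ l ∈ gapSet T m,
        (Polynomial.X : Polynomial ℤ) ^ (∑ r ∈ Finset.range (μ.card + 1), r * l r) := by
  rw [Finset.sum_sigma']
  symm
  have hmem : ∀ x ∈ (Finset.univ : Finset (StandardTableau μ)).sigma fun T => gapSet T m,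
      x.2 ∈ gapSet x.1 m := fun x hx => (Finset.mem_sigma.mp hx).2
  refine Finset.sum_bij (fun x hx => (⟨ofGaps x.1 x.2 (mem_gapSet.mp (hmem x hx)).2, fun c => by
    rw [ofGaps_apply]; exact gapValue_lt (hmem x hx) c⟩ : BoundedSSYT μ (m + 1))) ?_ ?_ ?_ ?_
  · intro x hx
    exact Finset.mem_univ _
  · rintro ⟨T, l⟩ hx ⟨T', l'⟩ hx' h
    have h1 : ∀ c, gapValue T l c = gapValue T' l' c := by
      intro c
      have := congrArg (fun S : BoundedSSYT μ (m + 1) => S.1 c.1.1 c.1.2) h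
      simpa only [ofGaps_apply] using this
    obtain ⟨rfl, rfl⟩ := gaps_injective (hmem _ hx) (hmem _ hx') h1
    rfl
  · intro S _
    obtain ⟨T, l, hl, h⟩ := exists_gaps S
    refine ⟨⟨T, l⟩, Finset.mem_sigma.mpr ⟨Finset.mem_univ _, hl⟩, ?_⟩
    refine Subtype.ext (SemistandardYoungTableau.ext fun i j => ?_)
    by_cases hc : (i, j) ∈ μ.cells
    · exact (ofGaps_apply T l (mem_gapSet.mp hl).2 ⟨(i, j), hc⟩).trans (h ⟨(i, j), hc⟩)
    · have hc' : (i, j) ∉ μ := fun h' => hc ((YoungDiagram.mem_cells _).mpr h')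
      rw [SemistandardYoungTableau.zeros _ hc', SemistandardYoungTableau.zeros _ hc']
  · intro x hx
    simp only [ofGaps_apply]
    rw [sum_sub_gapValue (hmem x hx)]

/-! ### The generating function -/

/-- The generating function of a single gap. -/
def gapSeries (T : StandardTableau μ) (j : ℕ) : PowerSeries (Polynomial ℤ) :=
  PowerSeries.mk fun g => if j ∈ descents T ∧ g = 0 then 0 else Polynomial.X ^ (j * g)

/-- A geometric series of ratio `q^j t`, starting at exponent `1` if `j` is a descent and at `0`
otherwise. -/
theorem gapSeries_mul (T : StandardTableau μ) (j : ℕ) :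
    gapSeries T j * (1 - PowerSeries.C ((Polynomial.X : Polynomial ℤ) ^ j) * PowerSeries.X) =
      if j ∈ descents T then
        PowerSeries.X * PowerSeries.C ((Polynomial.X : Polynomial ℤ) ^ j) else 1 := by
  ext1 n
  rw [mul_sub, mul_one, mul_left_comm, map_sub, PowerSeries.coeff_C_mul]
  rcases n with _ | n
  · by_cases h : j ∈ descents T <;> simp [gapSeries, h]
  · rw [PowerSeries.coeff_succ_mul_X]
    by_cases h : j ∈ descents T
    · rcases n with _ | n
      · simp [gapSeries, h, PowerSeries.coeff_succ_X_mul]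
      · simp [gapSeries, h, PowerSeries.coeff_X, ← pow_add,
          -map_pow]
        ring
    · simp [gapSeries, h, PowerSeries.coeff_one, ← pow_add]
      ring

theorem mk_principalSchur (μ : YoungDiagram) :
    PowerSeries.mk (fun m => principalSchur μ m) =
      ∑ T : StandardTableau μ, ∏ j ∈ Finset.range (μ.card + 1), gapSeries T j := by
  classical
  ext1 m
  rw [PowerSeries.coeff_mk, principalSchur_eq_reverse, sum_bounded_eq_sum_gaps, map_sum]
  refine Finset.sum_congr rfl fun T _ => ?_
  -- A coefficient of the product is a sum over all distributions of `m` among the gaps; the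
  -- vanishing constant terms of the descent factors discard the inadmissible ones.
  rw [PowerSeries.coeff_prod, gapSet, Finset.sum_filter]
  refine Finset.sum_congr rfl fun l _ => ?_
  have hsub : ∀ j ∈ descents T, j ∈ Finset.range (μ.card + 1) := by
    intro j hj
    obtain ⟨c, -, rfl, -⟩ := (T.mem_descents j).mp hj
    exact Finset.mem_range.mpr (Nat.lt_succ_of_le (T.pos_mem c).2)
  split_ifs with h
  · rw [← Finset.prod_pow_eq_pow_sum]
    refine Finset.prod_congr rfl fun j _ => ?_
    rw [gapSeries, PowerSeries.coeff_mk, if_neg]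
    rintro ⟨hj, h0⟩
    have := h j hj
    omega
  · push Not at h
    obtain ⟨j, hj, h0⟩ := h
    refine (Finset.prod_eq_zero (hsub j hj) ?_).symm
    rw [gapSeries, PowerSeries.coeff_mk, if_pos ⟨hj, by omega⟩]

theorem mk_principalSchur_mul (μ : YoungDiagram) :
    PowerSeries.mk (fun m => principalSchur μ m) * ∏ i ∈ Finset.range (μ.card + 1),
        (1 - PowerSeries.C ((Polynomial.X : Polynomial ℤ) ^ i) * PowerSeries.X) =
      ∑ S : StandardTableau μ, PowerSeries.X ^ des S *
        PowerSeries.C ((Polynomial.X : Polynomial ℤ) ^ maj S) := by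
  classical
  rw [mk_principalSchur, Finset.sum_mul]
  refine Finset.sum_congr rfl fun T _ => ?_
  rw [← Finset.prod_mul_distrib, Finset.prod_congr rfl fun j _ => gapSeries_mul T j,
    Finset.prod_ite_mem, Finset.inter_eq_right.mpr, Finset.prod_mul_distrib, Finset.prod_const,
    ← map_prod, Finset.prod_pow_eq_pow_sum]
  · rfl
  · intro j hj
    obtain ⟨c, -, rfl, -⟩ := (T.mem_descents j).mp hj
    exact Finset.mem_range.mpr (Nat.lt_succ_of_le (T.pos_mem c).2)

end

end Covariants

/-- The last equality is cleared of its denominator `∏_{i=0}^d (1 - q^i t)`, a unit of `ℤ[q]⟦t⟧`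
(its constant term is `1`). Here `q = Polynomial.X` and `t = PowerSeries.X`. The representation
`V_μ` is built from an arbitrary numbering `T` of the cells of `μ`. -/
theorem mainTheorem6 (k : Type*) [Field k] [IsAlgClosed k] [CharZero k] (d : ℕ)
    (μ : YoungDiagram) (hμ : μ.card = d) (T : μ.cells ≃ Fin d) :
    Covariants.equivariantHilbertSeries k T =
        PowerSeries.mk (fun m => Covariants.principalSchur μ m) ∧
      PowerSeries.mk (fun m => Covariants.principalSchur μ m) *
          ∏ i ∈ Finset.range (d + 1),
            (1 - PowerSeries.C ((Polynomial.X : Polynomial ℤ) ^ i) * PowerSeries.X) =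
        ∑ S : Covariants.StandardTableau μ,
          PowerSeries.X ^ Covariants.des S *
            PowerSeries.C ((Polynomial.X : Polynomial ℤ) ^ Covariants.maj S) := by
  subst hμ
  refine ⟨?_, Covariants.mk_principalSchur_mul μ⟩
  exact congrArg PowerSeries.mk (funext fun m => Covariants.character_eq_principalSchur T m)
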